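/- For a function $g:\mathbb{R}\to\mathbb{R}$ let $\mathrm{TV}(g)=\sup\sum_{n\in\mathbb{N}}|g(t_n)-g(t_{n+1})|$, the supremum being over all increasing sequences $(t_n)_{n\in\mathbb{N}}$ of reals. For $p\in\mathbb{N}$ and $C\ge 0$ let $\mathrm{GAM}_p(C)$ be the set of all functions $f:\mathbb{R}^p\to\mathbb{R}$ of the form $f(\mathbf{x})=\sum_{j=1}^p f_j(x_j)$, where each $f_j:\mathbb{R}\to\mathbb{R}$ is integrable with compact support and $\sum_{j=1}^p\mathrm{TV}(f_j)\le C$. Let $Y$ be a measurable space, let $m\ge 1$ and $p>2$ be integers, let $C\ge 0$, $\rho\ge 0$, $c>0$ and $\delta>0$, and let $(\mathbf{x},y),(\mathbf{x}_1,y_1),\dots,(\mathbf{x}_m,y_m)$ be i.i.d. random variables in $\mathbb{R}^p\times Y$. Let $\ell:\mathbb{R}\times Y\to\mathbb{R}$ be such that $\ell(a,\cdot)$ is measurable for every $a\in\mathbb{R}$, $\ell(\cdot,y)$ is $\rho$-Lipschitz for every $y\in Y$, and $|\ell|\le c$. Here $\log$ is the natural logarithm, and $\sqrt{t}$ is read as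 $0$ for $t<0$ (this occurs only if $\delta>2$, when both claims are trivial). Then: 1. For $$\epsilon=\sup_{f\in\mathrm{GAM}_p(C)}\Big(\mathbb{E}_{\mathbf{x},y}\,\ell(f(\mathbf{x}),y)-\frac1m\sum_{i=1}^m\ell(f(\mathbf{x}_i),y_i)\Big),$$ with probability at least $1-\delta$ over the sample $(\mathbf{x}_i,y_i)_{i=1}^m$, $$\epsilon\le\rho C\sqrt{\frac{5\lceil\log p\rceil}{m}}+c\sqrt{\frac{2\log(2/\delta)}{m}}.$$ 2. For $\ell^*=\inf_{f\in\mathrm{GAM}_p(C)}\mathbb{E}_{\mathbf{x},y}\,\ell(f(\mathbf{x}),y)$, with probability at least $1-\delta$ over the sample, every minimizer $\hat f$ of the empirical risk $f\mapsto\frac1m\sum_{i=1}^m\ell(f(\mathbf{x}_i),y_i)$ over $\mathrm{GAM}_p(C)$ satisfies $$\mathbb{E}_{\mathbf{x},y}\,\ell(\hat f(\mathbf{x}),y)\le\ell^*+\rho C\sqrt{\frac{5\lceil\log p\rceil}{m}}+5c\sqrt{\frac{2\log(2/\delta)}{m}}.$$ -/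

import Mathlib

open MeasureTheory ProbabilityTheory

open scoped NNReal ENNReal

/-- Functions `ℝ → ℝ` (honest pointwise functions, not almost-everywhere classes) that are
integrable with compact support. -/
def L1c : Set (ℝ → ℝ) :=
  {g | Integrable g volume ∧ HasCompactSupport g}

/-- Total variation over the whole line: `eVariationOn` is the supremum, over monotone sequences
`u : ℕ → ℝ` and over `n`, of the partial sums `∑ i < n, |g (u (i + 1)) - g (u i)|`. -/
noncomputable def totalVar (g : ℝ → ℝ) : ℝ≥0∞ :=
  eVariationOn g Set.univ

/-- TV-regularized generalized additive predictors on `ℝ^p`: the functions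
`x ↦ ∑ j, g j (x j)` with weight functions `g j` that are integrable with compact support and
whose total variations sum to at most `C`. -/
def GAM (p : ℕ) (C : ℝ≥0) : Set ((Fin p → ℝ) → ℝ) :=
  {f | ∃ g : Fin p → ℝ → ℝ, (∀ j, g j ∈ L1c) ∧ (∀ x, f x = ∑ j, g j (x j)) ∧
    ∑ j, totalVar (g j) ≤ (C : ℝ≥0∞)}

/-- Expected risk of the predictor `f` under the law `D` of a pair `(x, y)`. -/
noncomputable def expRisk {p : ℕ} {Y : Type*} [MeasurableSpace Y] (ℓ : ℝ → Y → ℝ)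
    (D : Measure ((Fin p → ℝ) × Y)) (f : (Fin p → ℝ) → ℝ) : ℝ :=
  ∫ z, ℓ (f z.1) z.2 ∂D

/-- Empirical risk of the predictor `f` on the sample `s`. -/
noncomputable def empRisk {p m : ℕ} {Y : Type*} (ℓ : ℝ → Y → ℝ)
    (s : Fin m → (Fin p → ℝ) × Y) (f : (Fin p → ℝ) → ℝ) : ℝ :=
  (1 / (m : ℝ)) * ∑ i, ℓ (f (s i).1) (s i).2

/-- Worst-case gap over the class between expected and empirical risk. -/
noncomputable def worstGap {p m : ℕ} {Y : Type*} [MeasurableSpace Y] (ℓ : ℝ → Y → ℝ)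
    (D : Measure ((Fin p → ℝ) × Y)) (C : ℝ≥0) (s : Fin m → (Fin p → ℝ) × Y) : ℝ :=
  ⨆ f : GAM p C, (expRisk ℓ D f.1 - empRisk ℓ s f.1)

/-- The optimal expected risk over the class. -/
noncomputable def optRisk {p : ℕ} {Y : Type*} [MeasurableSpace Y] (ℓ : ℝ → Y → ℝ)
    (D : Measure ((Fin p → ℝ) × Y)) (C : ℝ≥0) : ℝ :=
  ⨅ f : GAM p C, expRisk ℓ D f.1

/-- `f` minimizes the empirical risk on the sample `s` over the class. -/
def IsERM {p m : ℕ} {Y : Type*} (ℓ : ℝ → Y → ℝ) (C : ℝ≥0)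
    (s : Fin m → (Fin p → ℝ) × Y) (f : (Fin p → ℝ) → ℝ) : Prop :=
  f ∈ GAM p C ∧ IsMinOn (empRisk ℓ s) (GAM p C) f

/-- `E` has probability at least `q`. As `E` is not presumed measurable, this asks for a measurable
subset of `E` of probability at least `q`; for a measurable `E` it says `q ≤ μ.real E`. -/
def ProbAtLeast {Ω : Type*} [MeasurableSpace Ω] (μ : Measure Ω) (q : ℝ) (E : Set Ω) : Prop :=
  ∃ A : Set Ω, A ⊆ E ∧ MeasurableSet A ∧ q ≤ μ.real A

/-! The core is a bound for the Rademacher sums $\sum_i\sigma_i f(x_i)$ over the class. For one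
coordinate, sort the sample and sum by parts: the sum becomes one of increments of $f_j$ weighted by
the partial sums $S_k$ of the reordered signs. Because $f_j$ vanishes far out, a constant may be
subtracted from $S_k$; the midpoint of its range $R_j$ gives at most $\mathrm{TV}(f_j)R_j/2$
(`sum_coinSign_mul_le`). Hence the whole class contributes at most $\frac C2\max_j R_j$
(`sum_coinSign_mul_le_of_mem_GAM`).

The range is controlled by the largest rise and the largest fall of the walk. Each is dominated by
the running maximum of a walk reflected at 0, and a reflection argument (`sum_reflMax_le`) bounds
its exponential moments. A union bound over the $p$ coordinates then gives $\mathbb E\max_j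
R_j\le\sqrt{5\lceil\log p\rceil m}$ (`sum_iSup_coinRange_le`).

Contraction inserts the Lipschitz loss, symmetrization passes to the expected gap, and bounded
differences give concentration. Suprema over the uncountable class need not be measurable, so these
tools run on a countable subclass that generates the class under pointwise limits
(`exists_countable_generating_GAM`); risks are continuous under such limits, so the bound extends to
the class. -/

/-! ### Reflected coin walks and exponential moments of their ranges. -/

/-- The sign attached to a fair coin. -/
def coinSign (b : Bool) : ℤ := if b then 1 else -1

/-- The position after `k` steps of the walk driven by the coins `σ`. -/
def coinWalk {n : ℕ} (σ : Fin n → Bool) (k : ℕ) : ℤ :=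
  ∑ i, if i.val < k then coinSign (σ i) else 0

/-- The maximum of `M` and of the walk reflected at `0` started from `w`. -/
def reflMax : (n : ℕ) → (Fin n → Bool) → ℤ → ℤ → ℤ
  | 0, _, _, M => M
  | n + 1, σ, w, M =>
    reflMax n (Fin.tail σ) (max (w + coinSign (σ 0)) 0) (max M (max (w + coinSign (σ 0)) 0))

/-- The sum of `ψ` over the endpoints of all `n`-step walks started from `w`. -/
noncomputable def heatSum : ℕ → (ℤ → ℝ) → ℤ → ℝ
  | 0, ψ, w => ψ w
  | n + 1, ψ, w => heatSum n ψ (w + 1) + heatSum n ψ (w - 1)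

theorem sum_coin_succ {n : ℕ} (F : (Fin (n + 1) → Bool) → ℝ) :
    ∑ σ, F σ = ∑ σ : Fin n → Bool, F (Fin.cons true σ) +
      ∑ σ : Fin n → Bool, F (Fin.cons false σ) := by
  rw [← (Fin.consEquiv (fun _ : Fin (n + 1) => Bool)).sum_comp, Fintype.sum_prod_type]
  simp [Fin.consEquiv]

theorem coinWalk_zero {n : ℕ} (σ : Fin n → Bool) : coinWalk σ 0 = 0 := by
  simp [coinWalk]

theorem coinWalk_succ {n : ℕ} (σ : Fin (n + 1) → Bool) (k : ℕ) :
    coinWalk σ (k + 1) = coinSign (σ 0) + coinWalk (Fin.tail σ) k := by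
  simp [coinWalk, Fin.sum_univ_succ, Fin.tail]

theorem coinWalk_not {n : ℕ} (σ : Fin n → Bool) (k : ℕ) :
    coinWalk (fun i => !σ i) k = -coinWalk σ k := by
  unfold coinWalk
  rw [← Finset.sum_neg_distrib]
  refine Finset.sum_congr rfl fun i _ => ?_
  cases h : σ i <;> by_cases hk : i.val < k <;> simp [coinSign, h, hk]

theorem le_reflMax {n : ℕ} (σ : Fin n → Bool) (w M : ℤ) : M ≤ reflMax n σ w M := by
  induction n generalizing w M with
  | zero => simp [reflMax]
  | succ n ih => exact (le_max_left _ _).trans (ih _ _ _)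

theorem add_coinWalk_le_reflMax {n : ℕ} (σ : Fin n → Bool) {w M : ℤ} (hwM : w ≤ M) {k : ℕ}
    (hk : k ≤ n) : w + coinWalk σ k ≤ reflMax n σ w M := by
  induction n generalizing w M k with
  | zero =>
    obtain rfl : k = 0 := by omega
    simpa [reflMax, coinWalk_zero] using hwM
  | succ n ih =>
    cases k with
    | zero => simpa [coinWalk_zero] using hwM.trans (le_reflMax σ w M)
    | succ k =>
      rw [coinWalk_succ]
      have := ih (Fin.tail σ) (w := max (w + coinSign (σ 0)) 0)
        (M := max M (max (w + coinSign (σ 0)) 0)) (le_max_right _ _) (k := k) (by omega)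
      have h2 := le_max_left (w + coinSign (σ 0)) 0
      simp only [reflMax]
      linarith

/-- The reflected walk is nonnegative at time `l` and afterwards rises at least as fast as the free
walk, so at time `k` it dominates the rise since `l`. -/
theorem coinWalk_sub_le_reflMax {n : ℕ} (σ : Fin n → Bool) {w M : ℤ} (hw : 0 ≤ w) (hwM : w ≤ M)
    {k l : ℕ} (hl : l ≤ k) (hk : k ≤ n) : coinWalk σ k - coinWalk σ l ≤ reflMax n σ w M := by
  induction n generalizing w M k l with
  | zero =>
    obtain rfl : k = 0 := by omega
    obtain rfl : l = 0 := by omega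
    simpa [reflMax] using hw.trans hwM
  | succ n ih =>
    cases l with
    | zero =>
      have := add_coinWalk_le_reflMax σ hwM hk
      rw [coinWalk_zero]
      linarith
    | succ l =>
      obtain ⟨k, rfl⟩ : ∃ k', k = k' + 1 := ⟨k - 1, by omega⟩
      rw [coinWalk_succ, coinWalk_succ]
      have := ih (Fin.tail σ) (w := max (w + coinSign (σ 0)) 0)
        (M := max M (max (w + coinSign (σ 0)) 0)) (le_max_right _ _) (le_max_right _ _)
        (k := k) (l := l) (by omega) (by omega)
      simp only [reflMax]
      linarith

theorem heatSum_mono (n : ℕ) {ψ χ : ℤ → ℝ} (h : ∀ z, ψ z ≤ χ z) (w : ℤ) :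
    heatSum n ψ w ≤ heatSum n χ w := by
  induction n generalizing w with
  | zero => exact h w
  | succ n ih => exact add_le_add (ih _) (ih _)

theorem heatSum_add (n : ℕ) (ψ χ : ℤ → ℝ) (w : ℤ) :
    heatSum n (fun z => ψ z + χ z) w = heatSum n ψ w + heatSum n χ w := by
  induction n generalizing w with
  | zero => rfl
  | succ n ih => simp only [heatSum, ih]; ring

theorem heatSum_const_mul (n : ℕ) (a : ℝ) (ψ : ℤ → ℝ) (w : ℤ) :
    heatSum n (fun z => a * ψ z) w = a * heatSum n ψ w := by
  induction n generalizing w with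
  | zero => rfl
  | succ n ih => simp only [heatSum, ih]; ring

theorem heatSum_one (n : ℕ) (w : ℤ) : heatSum n (fun _ => 1) w = 2 ^ n := by
  induction n generalizing w with
  | zero => simp [heatSum]
  | succ n ih => simp only [heatSum, ih]; ring

theorem heatSum_reflect (n : ℕ) (ψ : ℤ → ℝ) (a w : ℤ) :
    heatSum n (fun z => ψ (a - z)) w = heatSum n ψ (a - w) := by
  induction n generalizing w with
  | zero => rfl
  | succ n ih =>
    simp only [heatSum, ih]
    rw [add_comm]
    congr 2 <;> ring

theorem heatSum_exp (n : ℕ) (t : ℝ) (w : ℤ) :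
    heatSum n (fun z => Real.exp (t * z)) w = (2 * Real.cosh t) ^ n * Real.exp (t * w) := by
  induction n generalizing w with
  | zero => simp [heatSum]
  | succ n ih =>
    simp only [heatSum, ih]
    push_cast
    rw [mul_add, mul_sub, Real.exp_add, sub_eq_add_neg, Real.exp_add, mul_one, pow_succ,
      mul_assoc ((2 * Real.cosh t) ^ n), Real.cosh_eq]
    ring

/-- Mirroring endpoints about the start preserves the sum, and of `z` and `2 * w - z` at least one
is `≥ w`. -/
theorem two_pow_le_heatSum_indicator (n : ℕ) (w : ℤ) :
    (2 : ℝ) ^ n ≤ 2 * heatSum n (fun z => if w ≤ z then 1 else 0) w := by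
  have h1 := heatSum_reflect n (fun z => if w ≤ z then (1 : ℝ) else 0) (2 * w) w
  rw [show 2 * w - w = w by ring] at h1
  rw [two_mul]
  nth_rewrite 1 [← h1]
  rw [← heatSum_add, ← heatSum_one n w]
  refine heatSum_mono n (fun z => ?_) w
  have hz : w ≤ 2 * w - z ∨ w ≤ z := by omega
  rcases hz with hz | hz <;> simp only [hz, if_true] <;> split_ifs <;> norm_num

/-- The reflection bound for the running maximum of the walk reflected at `0`. -/
theorem sum_reflMax_le {φ : ℤ → ℝ} (hφ : Monotone φ) (n : ℕ) (w M : ℤ) (hw : 0 ≤ w)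
    (hwM : w ≤ M) :
    ∑ σ : Fin n → Bool, φ (reflMax n σ w M) ≤
      2 ^ n * φ M + 2 * heatSum n (fun z => max (φ z - φ M) 0) w +
        2 * heatSum n (fun z => max (φ z - φ M) 0) (-w - 1) := by
  induction n generalizing w M with
  | zero =>
    have h1 : 0 ≤ max (φ w - φ M) 0 := le_max_right _ _
    have h2 : 0 ≤ max (φ (-w - 1) - φ M) 0 := le_max_right _ _
    simp [reflMax, heatSum]
    linarith
  | succ n ih =>
    rw [sum_coin_succ]
    simp only [reflMax, Fin.cons_zero, Fin.tail_cons, coinSign, if_true, Bool.false_eq_true,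
      if_false]
    have hup : max (w + 1) 0 = w + 1 := by omega
    have h1 := ih (w + 1) (max M (w + 1)) (by omega) (le_max_right _ _)
    have hdown : max M (max (w + -1) 0) = M := by omega
    have h2 := ih (max (w + -1) 0) M (le_max_right _ _) (by omega)
    rw [hup, hdown]
    -- For fixed `M` the bound solves the free heat recursion, so only the steps that hit the
    -- barrier at 0 or raise the maximum need an argument.
    set V : ℤ → ℤ → ℝ := fun w M => 2 ^ n * φ M + 2 * heatSum n (fun z => max (φ z - φ M) 0) w +
        2 * heatSum n (fun z => max (φ z - φ M) 0) (-w - 1) with hV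
    have hsplit : 2 ^ (n + 1) * φ M + 2 * heatSum (n + 1) (fun z => max (φ z - φ M) 0) w +
        2 * heatSum (n + 1) (fun z => max (φ z - φ M) 0) (-w - 1) = V (w + 1) M + V (w - 1) M := by
      simp only [hV, heatSum]
      rw [show -w - 1 + 1 = -(w - 1) - 1 by ring, show -w - 1 - 1 = -(w + 1) - 1 by ring]
      ring
    -- The barrier costs nothing: `V` is invariant under `w ↦ -w - 1`, which exchanges 0 and -1.
    have hdV : V (max (w + -1) 0) M = V (w - 1) M := by
      rcases hw.eq_or_lt with rfl | h
      · simp [hV]; ring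
      · rw [show max (w + -1) 0 = w - 1 by omega]
    -- A new maximum raises the first term by `2 ^ n * (φ (w + 1) - φ w)`. The doubled heat term
    -- pays for it, since at least half of the walks end no lower than they start.
    have huV : V (w + 1) (max M (w + 1)) ≤ V (w + 1) M := by
      rcases le_or_gt (w + 1) M with h | h
      · rw [max_eq_left h]
      · obtain rfl : w = M := by omega
        rw [max_eq_right h.le]
        have hd : 0 ≤ φ (w + 1) - φ w := sub_nonneg.2 (hφ h.le)
        have hA := heatSum_mono n (ψ := fun z => max (φ z - φ (w + 1)) 0 +
          (φ (w + 1) - φ w) * (if w + 1 ≤ z then 1 else 0))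
          (χ := fun z => max (φ z - φ w) 0) (fun z => by
            split_ifs with hz
            · have := hφ hz
              rw [max_eq_left (by linarith), max_eq_left (by linarith)]
              linarith
            · have := hφ (show z ≤ w + 1 by omega)
              rw [max_eq_right (by linarith)]
              simp) (w + 1)
        have hB := heatSum_mono n (ψ := fun z => max (φ z - φ (w + 1)) 0)
          (χ := fun z => max (φ z - φ w) 0)
          (fun z => max_le_max (by linarith) le_rfl) (-(w + 1) - 1)
        rw [heatSum_add, heatSum_const_mul] at hA
        have hC := mul_le_mul_of_nonneg_left (two_pow_le_heatSum_indicator n (w + 1)) hd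
        simp only [hV]
        linarith
    rw [hsplit]
    calc _ ≤ V (w + 1) (max M (w + 1)) + V (max (w + -1) 0) M := add_le_add h1 h2
      _ ≤ _ := by rw [hdV]; linarith

/-- The factor 5 is 1 + 2 + 2, from the three terms of the reflection bound with starting points 0
and -1; each heat sum is at most $(2\cosh t)^n$. -/
theorem sum_exp_reflMax_le (n : ℕ) {t : ℝ} (ht : 0 ≤ t) :
    ∑ σ : Fin n → Bool, Real.exp (t * reflMax n σ 0 0) ≤
      2 ^ n * (5 * Real.exp (n * t ^ 2 / 2)) := by
  have hmono : Monotone fun z : ℤ => Real.exp (t * z) := fun a b hab =>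
    Real.exp_le_exp.2 (mul_le_mul_of_nonneg_left (Int.cast_le.2 hab) ht)
  have h := sum_reflMax_le hmono n 0 0 le_rfl le_rfl
  have hb : ∀ w : ℤ, w ≤ 0 → heatSum n (fun z => max (Real.exp (t * z) - Real.exp (t * (0 : ℤ))) 0) w
      ≤ 2 ^ n * Real.exp (n * t ^ 2 / 2) := by
    intro w hw
    calc _ ≤ heatSum n (fun z => Real.exp (t * z)) w := heatSum_mono n (fun z => by
            simp [(Real.exp_pos _).le]) w
      _ = (2 * Real.cosh t) ^ n * Real.exp (t * w) := heatSum_exp n t w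
      _ ≤ (2 * Real.cosh t) ^ n * 1 := by
          refine mul_le_mul_of_nonneg_left (Real.exp_le_one_iff.2 ?_) (by positivity)
          exact mul_nonpos_of_nonneg_of_nonpos ht (by exact_mod_cast hw)
      _ = 2 ^ n * Real.cosh t ^ n := by rw [mul_one, mul_pow]
      _ ≤ 2 ^ n * Real.exp (t ^ 2 / 2) ^ n := by
          gcongr
          exact Real.cosh_le_exp_half_sq t
      _ = _ := by rw [← Real.exp_nat_mul]; ring_nf
  have h1 := hb 0 le_rfl
  have h2 := hb (-0 - 1) (by norm_num)
  have h3 : (2 : ℝ) ^ n * 1 ≤ 2 ^ n * Real.exp (n * t ^ 2 / 2) := by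
    gcongr
    exact Real.one_le_exp (by positivity)
  have h4 : (2 : ℝ) ^ n * Real.exp (t * (0 : ℤ)) = 2 ^ n * 1 := by simp
  beta_reduce at h
  rw [h4] at h
  calc _ ≤ _ := h
    _ ≤ 2 ^ n * Real.exp (n * t ^ 2 / 2) + 2 * (2 ^ n * Real.exp (n * t ^ 2 / 2)) +
        2 * (2 ^ n * Real.exp (n * t ^ 2 / 2)) :=
      add_le_add (add_le_add h3 (mul_le_mul_of_nonneg_left h1 zero_le_two))
        (mul_le_mul_of_nonneg_left h2 zero_le_two)
    _ = _ := by ring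

/-- An upper bound for the range of the walk driven by the coins `σ`. -/
def coinRange {n : ℕ} (σ : Fin n → Bool) : ℤ :=
  max (reflMax n σ 0 0) (reflMax n (fun i => !σ i) 0 0)

theorem coinWalk_sub_le_coinRange {n : ℕ} (σ : Fin n → Bool) {k l : ℕ} (hk : k ≤ n) (hl : l ≤ n) :
    coinWalk σ k - coinWalk σ l ≤ coinRange σ := by
  rcases le_total l k with h | h
  · exact (coinWalk_sub_le_reflMax σ le_rfl le_rfl h hk).trans (le_max_left _ _)
  · have := coinWalk_sub_le_reflMax (fun i => !σ i) le_rfl le_rfl h hl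
    rw [coinWalk_not, coinWalk_not] at this
    exact (by linarith : _ ≤ _).trans (this.trans (le_max_right _ _))

theorem sum_exp_coinRange_le (n : ℕ) {t : ℝ} (ht : 0 ≤ t) :
    ∑ σ : Fin n → Bool, Real.exp (t * coinRange σ) ≤
      2 ^ n * (10 * Real.exp (n * t ^ 2 / 2)) := by
  have h := sum_exp_reflMax_le n ht
  have hnot : ∑ σ : Fin n → Bool, Real.exp (t * reflMax n (fun i => !σ i) 0 0) =
      ∑ σ : Fin n → Bool, Real.exp (t * reflMax n σ 0 0) :=
    (Equiv.arrowCongr (Equiv.refl (Fin n)) Equiv.boolNot).sum_comp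
      (fun σ : Fin n → Bool => Real.exp (t * reflMax n σ 0 0))
  calc _ ≤ ∑ σ : Fin n → Bool, (Real.exp (t * reflMax n σ 0 0) +
        Real.exp (t * reflMax n (fun i => !σ i) 0 0)) := by
        refine Finset.sum_le_sum fun σ _ => ?_
        unfold coinRange
        rcases max_choice (reflMax n σ 0 0) (reflMax n (fun i => !σ i) 0 0) with h | h <;> rw [h]
        · linarith [Real.exp_pos (t * reflMax n (fun i => !σ i) 0 0)]
        · linarith [Real.exp_pos (t * reflMax n σ 0 0)]
    _ ≤ 2 ^ n * (5 * Real.exp (n * t ^ 2 / 2)) + 2 ^ n * (5 * Real.exp (n * t ^ 2 / 2)) := by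
        rw [Finset.sum_add_distrib, hnot]
        exact add_le_add h h
    _ = _ := by ring

/-! ### Rademacher sums of functions of bounded variation. -/

theorem exists_abs_coinWalk_sub_le {n : ℕ} (σ : Fin n → Bool) :
    ∃ a : ℝ, ∀ k ≤ n, |(coinWalk σ k : ℝ) - a| ≤ coinRange σ / 2 := by
  obtain ⟨k₁, h₁, hmax⟩ := (Finset.range (n + 1)).exists_max_image (coinWalk σ) ⟨0, by simp⟩
  obtain ⟨k₀, h₀, hmin⟩ := (Finset.range (n + 1)).exists_min_image (coinWalk σ) ⟨0, by simp⟩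
  rw [Finset.mem_range] at h₀ h₁
  have hR : (coinWalk σ k₁ : ℝ) - coinWalk σ k₀ ≤ coinRange σ := by
    exact_mod_cast coinWalk_sub_le_coinRange σ (by omega) (by omega)
  -- Centering at the midpoint of the extremes halves the range; this is the source of the later
  -- factor `C / 2`.
  refine ⟨(coinWalk σ k₁ + coinWalk σ k₀) / 2, fun k hk => ?_⟩
  have h1 : (coinWalk σ k : ℝ) ≤ coinWalk σ k₁ := by exact_mod_cast hmax k (by simp; omega)
  have h2 : (coinWalk σ k₀ : ℝ) ≤ coinWalk σ k := by exact_mod_cast hmin k (by simp; omega)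
  rw [abs_le]
  constructor <;> linarith

theorem coinWalk_succ_sub {n : ℕ} (σ : Fin n → Bool) (i : Fin n) :
    coinWalk σ (i + 1) - coinWalk σ i = coinSign (σ i) := by
  unfold coinWalk
  rw [← Finset.sum_sub_distrib, Finset.sum_eq_single i]
  · simp
  · intro j _ hj
    have : j.val ≠ i.val := fun h => hj (Fin.ext h)
    by_cases h : j.val < i.val
    · simp [h, show j.val < i.val + 1 by omega]
    · simp [h, show ¬ j.val < i.val + 1 by omega]
  · simp

theorem sum_mul_sub_by_parts (G b : ℕ → ℝ) (n : ℕ) :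
    ∑ i ∈ Finset.range n, G (i + 1) * (b (i + 1) - b i) =
      ∑ k ∈ Finset.range n, b k * (G k - G (k + 1)) + b n * G n - b 0 * G 0 := by
  induction n with
  | zero => simp
  | succ n ih => rw [Finset.sum_range_succ, Finset.sum_range_succ, ih]; ring

theorem exists_monotone_extension {n : ℕ} {x : Fin n → ℝ} (hx : Monotone x) {lo hi : ℝ}
    (hlo : ∀ i, lo ≤ x i) (hhi : ∀ i, x i ≤ hi) (hle : lo ≤ hi) :
    ∃ u : ℕ → ℝ, Monotone u ∧ u 0 = lo ∧ u (n + 1) = hi ∧ ∀ i : Fin n, u (i + 1) = x i := by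
  refine ⟨fun k => if k = 0 then lo else if h : k - 1 < n then x ⟨k - 1, h⟩ else hi,
    monotone_nat_of_le_succ fun k => ?_, by simp, by simp, fun i => by simp⟩
  rcases k with _ | k
  · simp only [if_true]
    split_ifs <;> simp_all
  · simp only [Nat.add_sub_cancel, Nat.succ_ne_zero, if_false]
    split_ifs with h1 h2 h2
    · exact hx (by simp [Fin.le_def])
    · exact hhi _
    · omega
    · rfl

theorem exists_zero_of_hasCompactSupport {g : ℝ → ℝ} (hg : HasCompactSupport g) {n : ℕ}
    (x : Fin n → ℝ) : ∃ lo hi, lo ≤ hi ∧ g lo = 0 ∧ g hi = 0 ∧ ∀ i, lo ≤ x i ∧ x i ≤ hi := by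
  rw [hasCompactSupport_iff_eventuallyEq, Filter.coclosedCompact_eq_cocompact,
    cocompact_eq_atBot_atTop] at hg
  obtain ⟨hb, ht⟩ := Filter.eventually_sup.1 hg
  obtain ⟨lo, h1, h2, h3⟩ := (hb.and ((Filter.eventually_all.2 fun i =>
    Filter.eventually_le_atBot (x i)).and (Filter.eventually_le_atBot (0 : ℝ)))).exists
  obtain ⟨hi, h4, h5, h6⟩ := (ht.and ((Filter.eventually_all.2 fun i =>
    Filter.eventually_ge_atTop (x i)).and (Filter.eventually_ge_atTop (0 : ℝ)))).exists
  exact ⟨lo, hi, h3.trans h6, h1, h4, fun i => ⟨h2 i, h5 i⟩⟩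

theorem sum_coinSign_mul_le_of_monotone {n : ℕ} (σ : Fin n → Bool) {x : Fin n → ℝ}
    (hx : Monotone x) {g : ℝ → ℝ} (hg : HasCompactSupport g) (hv : totalVar g ≠ ⊤) :
    ∑ i, (coinSign (σ i) : ℝ) * g (x i) ≤ (totalVar g).toReal * (coinRange σ / 2) := by
  obtain ⟨lo, hi, hle, h0, h1, hb⟩ := exists_zero_of_hasCompactSupport hg x
  obtain ⟨u, hu, hu0, hu1, hux⟩ :=
    exists_monotone_extension hx (fun i => (hb i).1) (fun i => (hb i).2) hle
  obtain ⟨a, ha⟩ := exists_abs_coinWalk_sub_le σ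
  have hR : (0 : ℝ) ≤ coinRange σ / 2 := (abs_nonneg _).trans (ha 0 (Nat.zero_le _))
  -- The zeros of `g` at `lo` and `hi` remove both boundary terms, so the shift `a` is free. The
  -- padded sequence has `n + 1` increments.
  have key : ∑ i, (coinSign (σ i) : ℝ) * g (x i) =
      ∑ k ∈ Finset.range (n + 1), ((coinWalk σ k : ℝ) - a) * (g (u k) - g (u (k + 1))) := by
    have := sum_mul_sub_by_parts (fun k => g (u k)) (fun k => (coinWalk σ k : ℝ) - a) n
    simp only [hu0, h0, mul_zero, sub_zero] at this
    rw [Finset.sum_range_succ, hu1, h1, sub_zero, ← this, Finset.sum_range]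
    refine Finset.sum_congr rfl fun i _ => ?_
    rw [hux, ← coinWalk_succ_sub σ i]
    push_cast
    ring
  have hvar : ∑ k ∈ Finset.range (n + 1), |g (u k) - g (u (k + 1))| ≤ (totalVar g).toReal := by
    have h := eVariationOn.sum_le (f := g) (s := Set.univ) (n := n + 1) hu fun i => Set.mem_univ _
    rw [← ENNReal.ofReal_le_iff_le_toReal hv, ENNReal.ofReal_sum_of_nonneg fun _ _ => abs_nonneg _]
    refine le_trans (le_of_eq (Finset.sum_congr rfl fun k _ => ?_)) h
    rw [edist_dist, Real.dist_eq, abs_sub_comm]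
  rw [key]
  calc _ ≤ ∑ k ∈ Finset.range (n + 1), (coinRange σ / 2 : ℝ) * |g (u k) - g (u (k + 1))| := by
        refine Finset.sum_le_sum fun k hk => (le_abs_self _).trans ?_
        rw [abs_mul]
        exact mul_le_mul_of_nonneg_right (ha k (by simpa [Nat.lt_succ_iff] using hk))
          (abs_nonneg _)
    _ ≤ _ := by
        rw [← Finset.mul_sum, mul_comm]
        exact mul_le_mul_of_nonneg_right hvar hR

theorem sum_coinSign_mul_le {n : ℕ} (σ : Fin n → Bool) (x : Fin n → ℝ) {g : ℝ → ℝ}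
    (hg : HasCompactSupport g) (hv : totalVar g ≠ ⊤) :
    ∑ i, (coinSign (σ i) : ℝ) * g (x i) ≤
      (totalVar g).toReal * (coinRange (σ ∘ Tuple.sort x) / 2) := by
  rw [← Equiv.sum_comp (Tuple.sort x) fun i => (coinSign (σ i) : ℝ) * g (x i)]
  exact sum_coinSign_mul_le_of_monotone (σ ∘ Tuple.sort x) (Tuple.monotone_sort x) hg hv

/-- Permuting fair coins does not change their joint law, so sorting along any coordinate is
harmless. -/
theorem sum_exp_coinRange_comp_le {n : ℕ} (τ : Equiv.Perm (Fin n)) {t : ℝ} (ht : 0 ≤ t) :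
    ∑ σ : Fin n → Bool, Real.exp (t * coinRange (σ ∘ τ)) ≤
      2 ^ n * (10 * Real.exp (n * t ^ 2 / 2)) := by
  refine le_trans (le_of_eq ?_) (sum_exp_coinRange_le n ht)
  exact (Equiv.arrowCongr τ.symm (Equiv.refl Bool)).sum_comp
    (fun σ : Fin n → Bool => Real.exp (t * coinRange σ))

/-- The maximal inequality for the ranges of `p` rearranged walks. -/
theorem sum_iSup_coinRange_le {p m : ℕ} (hp : 2 < p) (hm : 0 < m)
    (τ : Fin p → Equiv.Perm (Fin m)) :
    ∑ σ : Fin m → Bool, ⨆ j, (coinRange (σ ∘ τ j) : ℝ) ≤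
      2 ^ m * √(5 * (⌈Real.log p⌉₊ : ℝ) * m) := by
  have : Nonempty (Fin p) := ⟨⟨0, by omega⟩⟩
  set Q : (Fin m → Bool) → ℝ := fun σ => ⨆ j, (coinRange (σ ∘ τ j) : ℝ) with hQ
  set L : ℝ := (⌈Real.log p⌉₊ : ℝ) with hL
  have hp0 : (0 : ℝ) < p := by positivity
  have hm0 : (0 : ℝ) < m := by exact_mod_cast hm
  have hlogL : Real.log p ≤ L := Nat.le_ceil _
  -- Here `p ≥ 3 > e` forces `log p > 1`, so the ceiling is at least 2.
  have hL2 : 2 ≤ L := by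
    have h1 : 1 < Real.log p := by
      rw [Real.lt_log_iff_exp_lt hp0]
      have : (3 : ℝ) ≤ p := by exact_mod_cast hp
      linarith [Real.exp_one_lt_d9]
    have : 1 < ⌈Real.log p⌉₊ := by rw [Nat.lt_ceil]; simpa using h1
    rw [hL]; exact_mod_cast this
  -- With this `t` the exponents are `L` for the union over `p`, at most `3 / 2 * L` for the factor
  -- 10 (`10 ≤ e ^ 3` and `L ≥ 2`), and `5 / 2 * L` from the moment bound: `5 * L` in total.
  set t : ℝ := √(5 * L / m) with htdef
  have hq : 0 < 5 * L / m := by positivity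
  have ht : 0 < t := Real.sqrt_pos.2 hq
  have ht2 : t ^ 2 = 5 * L / m := Real.sq_sqrt hq.le
  have hB : m * t ^ 2 = 5 * L := by rw [ht2]; field_simp
  have htm : 5 * L / t = √(5 * L * m) := by
    rw [div_eq_iff ht.ne', htdef, ← Real.sqrt_mul (by positivity)]
    rw [show 5 * L * m * (5 * L / m) = (5 * L) ^ 2 by field_simp]
    exact (Real.sqrt_sq (by positivity)).symm
  have hexp : ∑ σ, Real.exp (t * Q σ) ≤ 2 ^ m * Real.exp (5 * L) := by
    calc _ ≤ ∑ σ : Fin m → Bool, ∑ j, Real.exp (t * coinRange (σ ∘ τ j)) := by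
          refine Finset.sum_le_sum fun σ _ => ?_
          obtain ⟨j, hj⟩ := exists_eq_ciSup_of_finite (f := fun j => (coinRange (σ ∘ τ j) : ℝ))
          simp only [hQ, ← hj]
          exact Finset.single_le_sum (f := fun j => Real.exp (t * coinRange (σ ∘ τ j)))
            (fun _ _ => (Real.exp_pos _).le) (Finset.mem_univ j)
      _ ≤ ∑ _j : Fin p, 2 ^ m * (10 * Real.exp (m * t ^ 2 / 2)) := by
          rw [Finset.sum_comm]
          exact Finset.sum_le_sum fun j _ => sum_exp_coinRange_comp_le (τ j) ht.le
      _ = 2 ^ m * (p * (10 * Real.exp (5 * L / 2))) := by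
          rw [Finset.sum_const, hB]; simp; ring
      _ ≤ 2 ^ m * (Real.exp L * (Real.exp (3 / 2 * L) * Real.exp (5 * L / 2))) := by
          gcongr
          · rwa [← Real.log_le_iff_le_exp hp0]
          · calc (10 : ℝ) ≤ Real.exp 1 ^ 3 := by
                  have := Real.exp_one_gt_d9
                  calc (10 : ℝ) ≤ 2.7 ^ 3 := by norm_num
                    _ ≤ _ := by gcongr; linarith
              _ = Real.exp 3 := by rw [← Real.exp_nat_mul]; norm_num
              _ ≤ _ := Real.exp_le_exp.2 (by linarith)
      _ = _ := by rw [← Real.exp_add, ← Real.exp_add]; ring_nf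
  -- The tangent line of `exp` at `5 * L` takes the place of Jensen's inequality.
  have hpt : ∀ σ, Q σ ≤ (5 * L - 1 + Real.exp (-(5 * L)) * Real.exp (t * Q σ)) / t := by
    intro σ
    rw [le_div_iff₀ ht, ← Real.exp_add]
    linarith [Real.add_one_le_exp (-(5 * L) + t * Q σ)]
  calc ∑ σ, Q σ ≤ ∑ σ, (5 * L - 1 + Real.exp (-(5 * L)) * Real.exp (t * Q σ)) / t :=
        Finset.sum_le_sum fun σ _ => hpt σ
    _ = (2 ^ m * (5 * L - 1) + Real.exp (-(5 * L)) * ∑ σ, Real.exp (t * Q σ)) / t := by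
        rw [← Finset.sum_div, Finset.sum_add_distrib, ← Finset.mul_sum]
        simp
        ring
    _ ≤ (2 ^ m * (5 * L - 1) + Real.exp (-(5 * L)) * (2 ^ m * Real.exp (5 * L))) / t := by
        gcongr
    _ = 2 ^ m * (5 * L / t) := by
        rw [mul_left_comm, ← Real.exp_add, neg_add_cancel, Real.exp_zero]; ring
    _ = _ := by rw [htm]

theorem totalVar_ne_top_of_sum_le {p : ℕ} {C : ℝ≥0} {g : Fin p → ℝ → ℝ}
    (hC : ∑ j, totalVar (g j) ≤ (C : ℝ≥0∞)) (j : Fin p) : totalVar (g j) ≠ ⊤ :=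
  ne_top_of_le_ne_top ENNReal.coe_ne_top
    ((Finset.single_le_sum (fun _ _ => zero_le) (Finset.mem_univ j)).trans hC)

theorem sum_toReal_totalVar_le {p : ℕ} {C : ℝ≥0} {g : Fin p → ℝ → ℝ}
    (hC : ∑ j, totalVar (g j) ≤ (C : ℝ≥0∞)) : ∑ j, (totalVar (g j)).toReal ≤ C := by
  rw [← ENNReal.toReal_sum fun j _ => totalVar_ne_top_of_sum_le hC j]
  exact ENNReal.toReal_mono ENNReal.coe_ne_top hC

theorem sum_coinSign_mul_le_of_mem_GAM {p m : ℕ} {C : ℝ≥0} {f : (Fin p → ℝ) → ℝ}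
    (hf : f ∈ GAM p C) (x : Fin m → Fin p → ℝ) (σ : Fin m → Bool) :
    ∑ i, (coinSign (σ i) : ℝ) * f (x i) ≤
      C / 2 * ⨆ j, (coinRange (σ ∘ Tuple.sort fun i => x i j) : ℝ) := by
  obtain ⟨g, hg, hfg, hC⟩ := hf
  set Q : ℝ := ⨆ j, (coinRange (σ ∘ Tuple.sort fun i => x i j) : ℝ) with hQ
  have hle : ∀ j, (coinRange (σ ∘ Tuple.sort fun i => x i j) : ℝ) ≤ Q := fun j =>
    le_ciSup (Set.finite_range fun j =>
      (coinRange (σ ∘ Tuple.sort fun i => x i j) : ℝ)).bddAbove j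
  have hQ0 : 0 ≤ Q := Real.iSup_nonneg fun j => by
    have := coinWalk_sub_le_coinRange (σ ∘ Tuple.sort fun i => x i j) (Nat.zero_le m)
      (Nat.zero_le m)
    rw [sub_self] at this
    exact_mod_cast this
  calc ∑ i, (coinSign (σ i) : ℝ) * f (x i)
      = ∑ j, ∑ i, (coinSign (σ i) : ℝ) * g j (x i j) := by
        simp_rw [hfg, Finset.mul_sum]
        exact Finset.sum_comm
    _ ≤ ∑ j, (totalVar (g j)).toReal * (Q / 2) := by
        refine Finset.sum_le_sum fun j _ => (sum_coinSign_mul_le σ (fun i => x i j) (hg j).2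
          (totalVar_ne_top_of_sum_le hC j)).trans ?_
        have := hle j
        gcongr
    _ ≤ C * (Q / 2) := by
        rw [← Finset.sum_mul]
        exact mul_le_mul_of_nonneg_right (sum_toReal_totalVar_le hC) (by positivity)
    _ = _ := by ring

/-! ### The contraction principle. -/

/-- `F` is a bounded real-valued family. -/
def BddFamily {ι : Type*} (F : ι → ℝ) : Prop := ∃ K, ∀ f, |F f| ≤ K

theorem BddFamily.bddAbove {ι : Type*} {F : ι → ℝ} (h : BddFamily F) :
    BddAbove (Set.range F) := by
  obtain ⟨K, hK⟩ := h
  exact ⟨K, by rintro _ ⟨f, rfl⟩; exact (le_abs_self _).trans (hK f)⟩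

theorem BddFamily.add {ι : Type*} {F G : ι → ℝ} (hF : BddFamily F) (hG : BddFamily G) :
    BddFamily fun f => F f + G f := by
  obtain ⟨K, hK⟩ := hF
  obtain ⟨K', hK'⟩ := hG
  exact ⟨K + K', fun f => (abs_add_le _ _).trans (add_le_add (hK f) (hK' f))⟩

theorem BddFamily.const_mul {ι : Type*} {F : ι → ℝ} (hF : BddFamily F) (a : ℝ) :
    BddFamily fun f => a * F f := by
  obtain ⟨K, hK⟩ := hF
  exact ⟨|a| * K, fun f => by
    rw [abs_mul]; exact mul_le_mul_of_nonneg_left (hK f) (abs_nonneg a)⟩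

theorem BddFamily.sub {ι : Type*} {F G : ι → ℝ} (hF : BddFamily F) (hG : BddFamily G) :
    BddFamily fun f => F f - G f := by
  simpa [sub_eq_add_neg] using hF.add (hG.const_mul (-1))

theorem BddFamily.sum {ι κ : Type*} (s : Finset κ) {F : κ → ι → ℝ} (hF : ∀ k, BddFamily (F k)) :
    BddFamily fun f => ∑ k ∈ s, F k f := by
  choose K hK using hF
  exact ⟨∑ k ∈ s, K k, fun f => (Finset.abs_sum_le_sum_abs _ _).trans
    (Finset.sum_le_sum fun k _ => hK k f)⟩

/-- This is contraction for a single coin. The left side is a supremum over pairs of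
$u_f+u_g+(s_f-s_g)$; after replacing the bracket by $|r_f-r_g|$, exchanging `f` and `g` removes the
absolute value. -/
theorem iSup_add_add_iSup_sub_le {ι : Type*} [Nonempty ι] {u s r : ι → ℝ} (hu : BddFamily u)
    (hr : BddFamily r) (hsr : ∀ f g, |s f - s g| ≤ |r f - r g|) :
    (⨆ f, (u f + s f)) + ⨆ f, (u f - s f) ≤ (⨆ f, (u f + r f)) + ⨆ f, (u f - r f) := by
  have hp := le_ciSup (hu.add hr).bddAbove
  have hm := le_ciSup (hu.sub hr).bddAbove
  have key : ∀ f g, (u f + s f) + (u g - s g) ≤ (⨆ f, (u f + r f)) + ⨆ f, (u f - r f) := by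
    intro f g
    have h := (le_abs_self _).trans (hsr f g)
    rcases abs_cases (r f - r g) with ⟨h', -⟩ | ⟨h', -⟩
    · linarith [hp f, hm g]
    · linarith [hp g, hm f]
  rw [← le_sub_iff_add_le]
  refine ciSup_le fun f => ?_
  rw [le_sub_iff_add_le, ← le_sub_iff_add_le']
  refine ciSup_le fun g => ?_
  rw [le_sub_iff_add_le']
  exact key f g

/-- The contraction principle for Rademacher averages, in comparison form. -/
theorem sum_iSup_coinSign_mul_le_of_contraction {ι : Type*} [Nonempty ι] {n : ℕ} {u : ι → ℝ}
    {s r : Fin n → ι → ℝ} (hu : BddFamily u) (hs : ∀ i, BddFamily (s i))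
    (hr : ∀ i, BddFamily (r i)) (hsr : ∀ i f g, |s i f - s i g| ≤ |r i f - r i g|) :
    ∑ σ : Fin n → Bool, ⨆ f, (u f + ∑ i, (coinSign (σ i) : ℝ) * s i f) ≤
      ∑ σ : Fin n → Bool, ⨆ f, (u f + ∑ i, (coinSign (σ i) : ℝ) * r i f) := by
  induction n generalizing u with
  | zero => simp
  | succ n ih =>
    have hsplit : ∀ q : Fin (n + 1) → ι → ℝ,
        ∑ σ : Fin (n + 1) → Bool, ⨆ f, (u f + ∑ i, (coinSign (σ i) : ℝ) * q i f) =
          ∑ σ : Fin n → Bool,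
            ((⨆ f, ((u f + ∑ i : Fin n, (coinSign (σ i) : ℝ) * q i.succ f) + q 0 f)) +
              ⨆ f, ((u f + ∑ i : Fin n, (coinSign (σ i) : ℝ) * q i.succ f) - q 0 f)) := by
      intro q
      rw [sum_coin_succ, Finset.sum_add_distrib]
      congr 1 <;> refine Finset.sum_congr rfl fun σ _ => iSup_congr fun f => ?_ <;>
        rw [Fin.sum_univ_succ] <;> simp [coinSign] <;> ring
    rw [hsplit s, hsplit r]
    have hb : ∀ σ : Fin n → Bool,
        BddFamily fun f => u f + ∑ i : Fin n, (coinSign (σ i) : ℝ) * s i.succ f := fun σ =>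
      hu.add (BddFamily.sum _ fun i => (hs i.succ).const_mul _)
    refine (Finset.sum_le_sum fun σ _ =>
      iSup_add_add_iSup_sub_le (hb σ) (hr 0) (hsr 0)).trans ?_
    rw [Finset.sum_add_distrib]
    -- The exchanged first term is absorbed into the offset `u`, once with each sign.
    have h1 := ih (u := fun f => u f + r 0 f) (s := fun i => s i.succ) (r := fun i => r i.succ)
      (hu.add (hr 0)) (fun i => hs _) (fun i => hr _) fun i => hsr _
    have h2 := ih (u := fun f => u f - r 0 f) (s := fun i => s i.succ) (r := fun i => r i.succ)
      (hu.sub (hr 0)) (fun i => hs _) (fun i => hr _) fun i => hsr _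
    simp only [add_right_comm _ (∑ _, _), add_sub_right_comm] at h1 h2 ⊢
    exact (add_le_add h1 h2).trans_eq Finset.sum_add_distrib.symm

/-! ### Concentration by bounded differences. -/

theorem integrable_of_abs_le {X : Type*} [MeasurableSpace X] {P : Measure X} [IsFiniteMeasure P]
    {F : X → ℝ} (hF : Measurable F) {K : ℝ} (hK : ∀ x, |F x| ≤ K) : Integrable F P :=
  Integrable.of_bound hF.aestronglyMeasurable K (Filter.Eventually.of_forall hK)

theorem abs_integral_le_of_abs_le {X : Type*} [MeasurableSpace X] {P : Measure X}
    [IsProbabilityMeasure P] {F : X → ℝ} {K : ℝ} (hK : ∀ x, |F x| ≤ K) : |∫ x, F x ∂P| ≤ K := by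
  have h : ∀ x, ‖F x‖ ≤ K := hK
  simpa using norm_integral_le_of_norm_le_const (μ := P) (Filter.Eventually.of_forall h)

theorem integrable_exp_of_abs_le {X : Type*} [MeasurableSpace X] {P : Measure X}
    [IsFiniteMeasure P] {F : X → ℝ} (hF : Measurable F) {K : ℝ} (hK : ∀ x, |F x| ≤ K) (t a : ℝ) :
    Integrable (fun x => Real.exp (t * (F x - a))) P := by
  refine integrable_of_abs_le (by fun_prop) (K := Real.exp (|t| * (K + |a|))) fun x => ?_
  rw [Real.abs_exp]
  refine Real.exp_le_exp.2 ((le_abs_self _).trans ?_)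
  rw [abs_mul]
  refine mul_le_mul_of_nonneg_left ((abs_sub _ _).trans ?_) (abs_nonneg t)
  gcongr
  exact hK x

theorem integral_pi_fin_succ {X : Type*} [MeasurableSpace X] (D : Measure X)
    [IsProbabilityMeasure D] {n : ℕ} {F : (Fin (n + 1) → X) → ℝ}
    (hF : Integrable F (Measure.pi fun _ => D)) :
    ∫ s, F s ∂(Measure.pi fun _ => D) =
      ∫ x, ∫ s : Fin n → X, F (Fin.cons x s) ∂(Measure.pi fun _ => D) ∂D := by
  have hmp := (measurePreserving_piFinSuccAbove (fun _ : Fin (n + 1) => D) 0).symm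
  rw [← hmp.integral_comp' F]
  have hint : Integrable (fun z => F ((MeasurableEquiv.piFinSuccAbove (fun _ => X) 0).symm z))
      (D.prod (Measure.pi fun _ : Fin n => D)) :=
    (hmp.integrable_comp_emb (MeasurableEquiv.measurableEmbedding _)).2 hF
  rw [integral_prod _ hint]
  simp [MeasurableEquiv.piFinSuccAbove_symm_apply, Fin.insertNthEquiv, Fin.insertNth_zero']

theorem measurable_cons {X : Type*} [MeasurableSpace X] {n : ℕ} :
    Measurable fun z : X × (Fin n → X) => (Fin.cons z.1 z.2 : Fin (n + 1) → X) := by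
  refine measurable_pi_iff.2 fun i => ?_
  refine Fin.cases ?_ (fun i => ?_) i
  · simpa using measurable_fst
  · simpa [Function.comp_def] using (measurable_pi_apply i).comp measurable_snd

/-- The moment generating function bound behind McDiarmid's inequality. -/
theorem integral_exp_le_of_bounded_differences {X : Type*} [MeasurableSpace X] (D : Measure X)
    [IsProbabilityMeasure D] {b : ℝ} (hb : 0 ≤ b) (t : ℝ) {n : ℕ} {Φ : (Fin n → X) → ℝ}
    (hΦ : Measurable Φ) {K : ℝ} (hK : ∀ s, |Φ s| ≤ K)
    (hdiff : ∀ s i x, |Φ s - Φ (Function.update s i x)| ≤ b) :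
    ∫ s, Real.exp (t * (Φ s - ∫ s', Φ s' ∂(Measure.pi fun _ => D))) ∂(Measure.pi fun _ => D) ≤
      Real.exp (n * (b / 2) ^ 2 * t ^ 2 / 2) := by
  induction n with
  | zero =>
    have h : ∀ s, Φ s = Φ default := fun s => congrArg Φ (Subsingleton.elim _ _)
    simp [h]
  | succ n ih =>
    have hX : Nonempty X := nonempty_of_isProbabilityMeasure D
    set P : Measure (Fin n → X) := Measure.pi fun _ => D with hP
    set E := ∫ s', Φ s' ∂(Measure.pi fun _ => D) with hE
    have hcons : ∀ x, Measurable fun s : Fin n → X => Φ (Fin.cons x s) := fun x =>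
      hΦ.comp (measurable_cons.comp measurable_prodMk_left)
    -- `Ψ` is the conditional mean given the first coordinate. The induction hypothesis handles the
    -- fluctuation about `Ψ x`; Hoeffding's lemma handles `Ψ`, whose values lie in an interval of
    -- length `b`.
    set Ψ : X → ℝ := fun x => ∫ s, Φ (Fin.cons x s) ∂P with hΨ
    have hΨm : Measurable Ψ :=
      (StronglyMeasurable.integral_prod_right
        (f := fun x (s : Fin n → X) => Φ (Fin.cons x s))
        (hΦ.comp measurable_cons).stronglyMeasurable).measurable
    have hΨK : ∀ x, |Ψ x| ≤ K := fun x => abs_integral_le_of_abs_le fun s => hK _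
    have hEΨ : E = ∫ x, Ψ x ∂D := integral_pi_fin_succ D (integrable_of_abs_le hΦ hK)
    have hΨdiff : ∀ x y, Ψ x ≤ Ψ y + b := by
      intro x y
      have hconst : Ψ y + b = ∫ s, (Φ (Fin.cons y s) + b) ∂P := by
        rw [integral_add (integrable_of_abs_le (hcons y) fun s => hK _) (integrable_const b)]
        simp [hΨ]
      rw [hconst]
      refine integral_mono (integrable_of_abs_le (hcons x) fun s => hK _)
        (integrable_of_abs_le ((hcons y).add_const b) (K := K + b) fun s => ?_) fun s => ?_
      · refine (abs_add_le _ _).trans (add_le_add (hK _) (abs_of_nonneg hb).le)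
      · have h := hdiff (Fin.cons x s) 0 y
        rw [Fin.update_cons_zero] at h
        simp only
        linarith [le_abs_self (Φ (Fin.cons x s) - Φ (Fin.cons y s))]
    rw [integral_pi_fin_succ D (integrable_exp_of_abs_le hΦ hK t E)]
    have hinner : ∀ x, ∫ s, Real.exp (t * (Φ (Fin.cons x s) - E)) ∂P ≤
        Real.exp (t * (Ψ x - E)) * Real.exp (n * (b / 2) ^ 2 * t ^ 2 / 2) := by
      intro x
      have h : ∀ s, Real.exp (t * (Φ (Fin.cons x s) - E)) =
          Real.exp (t * (Ψ x - E)) * Real.exp (t * (Φ (Fin.cons x s) - Ψ x)) := fun s => by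
        rw [← Real.exp_add]; ring_nf
      simp_rw [h]
      rw [integral_const_mul]
      refine mul_le_mul_of_nonneg_left (ih (hcons x) (fun s => hK _) fun s i y => ?_)
        (Real.exp_pos _).le
      rw [Fin.cons_update]
      exact hdiff _ _ _
    have hbdd : BddBelow (Set.range Ψ) :=
      ⟨-K, by rintro _ ⟨x, rfl⟩; exact (abs_le.1 (hΨK x)).1⟩
    have hmem : ∀ x, Ψ x ∈ Set.Icc (⨅ y, Ψ y) ((⨅ y, Ψ y) + b) := fun x =>
      ⟨ciInf_le hbdd x, by
        rw [← sub_le_iff_le_add]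
        exact le_ciInf fun y => by linarith [hΨdiff x y]⟩
    have hsub := hasSubgaussianMGF_of_mem_Icc (μ := D) hΨm.aemeasurable
      (Filter.Eventually.of_forall hmem)
    have hmgf := hsub.mgf_le t
    have hcoe : (((‖(⨅ y, Ψ y) + b - ⨅ y, Ψ y‖₊ / 2) ^ 2 : ℝ≥0) : ℝ) = (b / 2) ^ 2 := by
      simp [abs_of_nonneg hb]
    rw [hcoe] at hmgf
    calc ∫ x, ∫ s, Real.exp (t * (Φ (Fin.cons x s) - E)) ∂P ∂D
        ≤ ∫ x, Real.exp (t * (Ψ x - E)) * Real.exp (n * (b / 2) ^ 2 * t ^ 2 / 2) ∂D := by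
          refine integral_mono_of_nonneg (Filter.Eventually.of_forall fun x =>
            integral_nonneg fun s => (Real.exp_pos _).le)
            ((integrable_exp_of_abs_le hΨm hΨK t E).mul_const _)
            (Filter.Eventually.of_forall hinner)
      _ = mgf (fun x => Ψ x - ∫ y, Ψ y ∂D) D t * Real.exp (n * (b / 2) ^ 2 * t ^ 2 / 2) := by
          rw [integral_mul_const, hEΨ]
          rfl
      _ ≤ Real.exp ((b / 2) ^ 2 * t ^ 2 / 2) * Real.exp (n * (b / 2) ^ 2 * t ^ 2 / 2) := by
          gcongr
      _ = _ := by
          rw [← Real.exp_add]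
          push_cast
          ring_nf

/-- McDiarmid's bounded differences inequality. -/
theorem measureReal_ge_le_of_bounded_differences {X : Type*} [MeasurableSpace X] (D : Measure X)
    [IsProbabilityMeasure D] {b : ℝ} (hb : 0 ≤ b) {n : ℕ} {Φ : (Fin n → X) → ℝ}
    (hΦ : Measurable Φ) {K : ℝ} (hK : ∀ s, |Φ s| ≤ K)
    (hdiff : ∀ s i x, |Φ s - Φ (Function.update s i x)| ≤ b) {r : ℝ} (hr : 0 ≤ r) :
    (Measure.pi fun _ => D).real {s | ∫ s', Φ s' ∂(Measure.pi fun _ => D) + r ≤ Φ s} ≤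
      Real.exp (-r ^ 2 / (2 * (n * (b / 2) ^ 2))) := by
  have hsub : HasSubgaussianMGF (fun s => Φ s - ∫ s', Φ s' ∂(Measure.pi fun _ => D))
      (n * (b.toNNReal / 2) ^ 2) (Measure.pi fun _ : Fin n => D) :=
    ⟨fun t => integrable_exp_of_abs_le hΦ hK t _, fun t => by
      have := integral_exp_le_of_bounded_differences D hb t hΦ hK hdiff
      simpa [mgf, hb] using this⟩
  have h := hsub.measure_ge_le hr
  simp only [le_sub_iff_add_le'] at h
  simpa [hb] using h

/-! ### Symmetrization. -/

theorem bddFamily_of_abs_le {ι : Type*} {F : ι → ℝ} {K : ℝ} (h : ∀ f, |F f| ≤ K) : BddFamily F :=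
  ⟨K, h⟩

theorem abs_iSup_le {ι : Type*} [Nonempty ι] {F : ι → ℝ} {K : ℝ} (h : ∀ f, |F f| ≤ K) :
    |⨆ f, F f| ≤ K := by
  obtain ⟨f⟩ := ‹Nonempty ι›
  rw [abs_le]
  exact ⟨(abs_le.1 (h f)).1.trans (le_ciSup (bddFamily_of_abs_le h).bddAbove f),
    ciSup_le fun f => (abs_le.1 (h f)).2⟩

theorem abs_average_le {m : ℕ} (hm : 0 < m) {a : Fin m → ℝ} {c : ℝ} (ha : ∀ i, |a i| ≤ c) :
    |1 / (m : ℝ) * ∑ i, a i| ≤ c := by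
  have hm0 : (0 : ℝ) < m := by exact_mod_cast hm
  rw [abs_mul, abs_of_pos (by positivity), one_div_mul_eq_div, div_le_iff₀ hm0]
  refine (Finset.abs_sum_le_sum_abs _ _).trans ((Finset.sum_le_sum fun i _ => ha i).trans ?_)
  simp [mul_comm]

/-- Symmetrization: the expected supremum of the empirical process is at most twice the
Rademacher average, bounded uniformly over samples. -/
theorem integral_iSup_gap_le {X ι : Type*} [MeasurableSpace X] [Countable ι] [Nonempty ι]
    (D : Measure X) [IsProbabilityMeasure D] {m : ℕ} (hm : 0 < m) {h : ι → X → ℝ} {c B : ℝ}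
    (hh : ∀ f, Measurable (h f)) (hc : ∀ f x, |h f x| ≤ c)
    (hB : ∀ s : Fin m → X,
      ∑ σ : Fin m → Bool, ⨆ f, ∑ i, (coinSign (σ i) : ℝ) * h f (s i) ≤ 2 ^ m * B) :
    ∫ s : Fin m → X, ⨆ f, (∫ x, h f x ∂D - 1 / (m : ℝ) * ∑ i, h f (s i))
      ∂(Measure.pi fun _ => D) ≤ 2 / m * B := by
  have hm0 : (0 : ℝ) < m := by exact_mod_cast hm
  set P : Measure (Fin m → X) := Measure.pi fun _ => D with hP
  have hbd : ∀ (σ : Fin m → Bool) (z : Fin m → X × X) (f : ι),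
      |1 / (m : ℝ) * ∑ i, (coinSign (σ i) : ℝ) * (h f (z i).2 - h f (z i).1)| ≤ 2 * c := by
    intro σ z f
    refine abs_average_le hm fun i => ?_
    have h1 : |(coinSign (σ i) : ℝ)| = 1 := by cases σ i <;> simp [coinSign]
    rw [abs_mul, h1, one_mul]
    exact (abs_sub _ _).trans (by linarith [hc f (z i).1, hc f (z i).2])
  -- First components are the sample, second components an independent ghost sample.
  set W : (Fin m → Bool) → (Fin m → X × X) → ℝ := fun σ z =>
    ⨆ f, 1 / (m : ℝ) * ∑ i, (coinSign (σ i) : ℝ) * (h f (z i).2 - h f (z i).1) with hW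
  have hWm : ∀ σ, Measurable (W σ) := fun σ => Measurable.iSup fun f => by
    refine (Finset.measurable_sum _ fun i _ => ?_).const_mul _
    exact (((hh f).comp (measurable_snd.comp (measurable_pi_apply i))).sub
      ((hh f).comp (measurable_fst.comp (measurable_pi_apply i)))).const_mul _
  have hWb : ∀ σ z, |W σ z| ≤ 2 * c := fun σ z => abs_iSup_le fun f => hbd σ z f
  set P2 : Measure (Fin m → X × X) := Measure.pi fun _ => D.prod D with hP2
  -- Exchanging sample and ghost at the indices where the coin is `false` preserves the law and
  -- flips exactly those signs.
  have hswap : ∀ σ, ∫ z, W σ z ∂P2 = ∫ z, W (fun _ => true) z ∂P2 := by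
    intro σ
    have hmp : MeasurePreserving (fun (z : Fin m → X × X) i =>
        (if σ i then id else Prod.swap : X × X → X × X) (z i)) P2 P2 :=
      measurePreserving_pi _ _ fun i => by
        split_ifs
        · exact MeasurePreserving.id _
        · exact Measure.measurePreserving_swap
    rw [← hmp.map_eq]
    nth_rewrite 2 [hmp.map_eq]
    rw [integral_map hmp.measurable.aemeasurable (hWm _).aestronglyMeasurable]
    refine integral_congr_ae (Filter.Eventually.of_forall fun z => ?_)
    refine iSup_congr fun f => ?_
    congr 1
    refine Finset.sum_congr rfl fun i _ => ?_
    cases h : σ i <;> simp [coinSign, h]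
  -- The expected risk is the mean over the ghost sample, and a supremum of means is at most the
  -- mean of the supremum.
  have hpair : ∫ s, (⨆ f, (∫ x, h f x ∂D - 1 / (m : ℝ) * ∑ i, h f (s i))) ∂P ≤
      ∫ z, W (fun _ => true) z ∂P2 := by
    have hmp := (measurePreserving_arrowProdEquivProdArrow X X (Fin m) (fun _ => D)
      (fun _ => D)).symm
    rw [← hmp.integral_comp' (W fun _ => true)]
    have hFm : Measurable fun q : (Fin m → X) × (Fin m → X) =>
        W (fun _ => true) ((MeasurableEquiv.arrowProdEquivProdArrow X X (Fin m)).symm q) :=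
      (hWm _).comp (MeasurableEquiv.measurable _)
    rw [integral_prod _ (integrable_of_abs_le hFm fun q => hWb _ _)]
    refine integral_mono (integrable_of_abs_le (Measurable.iSup fun f => ?_)
      (K := 2 * c) fun s => abs_iSup_le fun f => ?_)
      (integrable_of_abs_le (StronglyMeasurable.integral_prod_right
        hFm.stronglyMeasurable).measurable fun s => abs_integral_le_of_abs_le fun s' => hWb _ _)
      fun s => ?_
    · exact measurable_const.sub ((Finset.measurable_sum _ fun i _ =>
        (hh f).comp (measurable_pi_apply i)).const_mul _)
    · refine (abs_sub _ _).trans ?_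
      have h1 := abs_integral_le_of_abs_le (P := D) (hc f)
      have h2 := abs_average_le hm (fun i => hc f (s i))
      linarith
    · refine ciSup_le fun f => ?_
      have hmean : ∫ s' : Fin m → X, 1 / (m : ℝ) * ∑ i, (h f (s' i) - h f (s i)) ∂P =
          ∫ x, h f x ∂D - 1 / (m : ℝ) * ∑ i, h f (s i) := by
        have hi : ∀ i, Integrable (fun s' : Fin m → X => h f (s' i)) P := fun i =>
          integrable_of_abs_le ((hh f).comp (measurable_pi_apply i)) fun s' => hc f _
        have he : ∀ i, ∫ s' : Fin m → X, h f (s' i) ∂P = ∫ x, h f x ∂D := fun i =>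
          integral_comp_eval (μ := fun _ : Fin m => D) (hh f).aestronglyMeasurable
        have hi' : ∀ i, Integrable (fun s' : Fin m → X => h f (s' i) - h f (s i)) P := fun i =>
          (hi i).sub (integrable_const _)
        rw [integral_const_mul, integral_finsetSum _ fun i _ => hi' i]
        simp_rw [integral_sub (hi _) (integrable_const _), he]
        simp [Finset.sum_sub_distrib]
        field_simp
      rw [← hmean]
      refine integral_mono (integrable_of_abs_le ((Finset.measurable_sum _ fun i _ =>
        ((hh f).comp (measurable_pi_apply i)).sub_const _).const_mul _) (K := 2 * c) fun s' => ?_)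
        (integrable_of_abs_le (hFm.comp measurable_prodMk_left) fun s' => hWb _ _) fun s' => ?_
      · simpa [coinSign] using hbd (fun _ => true) (fun i => (s i, s' i)) f
      · have := le_ciSup (bddFamily_of_abs_le (hbd (fun _ => true)
          (fun i => (s i, s' i)))).bddAbove f
        refine le_trans (le_of_eq ?_) this
        simp [coinSign]
  have hpoint : ∀ z, ∑ σ, W σ z ≤ 2 ^ m * (2 / m * B) := by
    intro z
    have hb : ∀ (σ : Fin m → Bool) (s : Fin m → X),
        BddFamily fun f => ∑ i, (coinSign (σ i) : ℝ) * h f (s i) := fun σ s =>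
      BddFamily.sum _ fun i => BddFamily.const_mul ⟨c, fun f => hc f (s i)⟩ _
    have hnot : ∑ σ : Fin m → Bool, ⨆ f, ∑ i, (coinSign (!σ i) : ℝ) * h f (z i).1 ≤ 2 ^ m * B := by
      refine le_trans (le_of_eq ?_) (hB fun i => (z i).1)
      exact (Equiv.arrowCongr (Equiv.refl (Fin m)) Equiv.boolNot).sum_comp
        (fun σ : Fin m → Bool => ⨆ f, ∑ i, (coinSign (σ i) : ℝ) * h f (z i).1)
    calc ∑ σ, W σ z ≤ ∑ σ : Fin m → Bool, 1 / (m : ℝ) *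
          ((⨆ f, ∑ i, (coinSign (σ i) : ℝ) * h f (z i).2) +
            ⨆ f, ∑ i, (coinSign (!σ i) : ℝ) * h f (z i).1) := by
          refine Finset.sum_le_sum fun σ _ => ciSup_le fun f => ?_
          refine mul_le_mul_of_nonneg_left ?_ (by positivity)
          have h1 := le_ciSup (hb σ fun i => (z i).2).bddAbove f
          have h2 := le_ciSup (hb (fun i => !σ i) fun i => (z i).1).bddAbove f
          refine le_trans (le_of_eq ?_) (add_le_add h1 h2)
          rw [← Finset.sum_add_distrib]
          refine Finset.sum_congr rfl fun i _ => ?_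
          cases σ i <;> simp [coinSign] <;> ring
      _ ≤ 1 / (m : ℝ) * (2 ^ m * B + 2 ^ m * B) := by
          rw [← Finset.mul_sum, Finset.sum_add_distrib]
          refine mul_le_mul_of_nonneg_left (add_le_add (hB fun i => (z i).2) hnot) (by positivity)
      _ = _ := by ring
  have hsum : 2 ^ m * ∫ z, W (fun _ => true) z ∂P2 = ∫ z, ∑ σ, W σ z ∂P2 := by
    rw [integral_finsetSum _ fun σ _ => integrable_of_abs_le (hWm σ) (hWb σ)]
    simp [hswap]
  have hle : ∫ z, ∑ σ, W σ z ∂P2 ≤ 2 ^ m * (2 / m * B) := by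
    have := integral_mono (μ := P2) (integrable_finsetSum _ fun σ (_ : σ ∈ Finset.univ) =>
      integrable_of_abs_le (hWm σ) (hWb σ)) (integrable_const (2 ^ m * (2 / m * B))) hpoint
    simpa using this
  rw [← hsum] at hle
  exact hpair.trans (le_of_mul_le_mul_left hle (by positivity))
-- Countable generation of the additive class.
open Filter Topology

theorem exists_monotone_sub_of_totalVar_ne_top {g : ℝ → ℝ} (hv : totalVar g ≠ ⊤) :
    ∃ a b : ℝ → ℝ, Monotone a ∧ Monotone b ∧ g = a - b := by
  have hbv : BoundedVariationOn g Set.univ := hv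
  obtain ⟨a, b, ha, hb, h⟩ :=
    hbv.locallyBoundedVariationOn.exists_monotoneOn_sub_monotoneOn
  exact ⟨a, b, monotoneOn_univ.1 ha, monotoneOn_univ.1 hb, h⟩

theorem measurable_of_totalVar_ne_top {g : ℝ → ℝ} (hv : totalVar g ≠ ⊤) : Measurable g := by
  obtain ⟨a, b, ha, hb, rfl⟩ := exists_monotone_sub_of_totalVar_ne_top hv
  exact ha.measurable.sub hb.measurable

theorem countable_not_continuousAt_of_totalVar_ne_top {g : ℝ → ℝ} (hv : totalVar g ≠ ⊤) :
    {x | ¬ContinuousAt g x}.Countable := by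
  obtain ⟨a, b, ha, hb, rfl⟩ := exists_monotone_sub_of_totalVar_ne_top hv
  refine (ha.countable_not_continuousAt.union hb.countable_not_continuousAt).mono fun x hx => ?_
  by_contra hcon
  simp only [Set.mem_union, Set.mem_ofPred_eq, not_or, not_not] at hcon
  exact hx (hcon.1.sub hcon.2)

theorem abs_le_totalVar {g : ℝ → ℝ} (hg : HasCompactSupport g) (hv : totalVar g ≠ ⊤) (x : ℝ) :
    |g x| ≤ (totalVar g).toReal := by
  obtain ⟨lo, -, -, h0, -⟩ := exists_zero_of_hasCompactSupport hg (fun _ : Fin 0 => (0 : ℝ))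
  have h := BoundedVariationOn.dist_le (f := g) (s := Set.univ) hv (Set.mem_univ x)
    (Set.mem_univ lo)
  rwa [Real.dist_eq, h0, sub_zero] at h

/-- Finite variation makes `g` measurable and, with compact support, bounded; integrability follows.
-/
theorem mem_L1c_of_hasCompactSupport {g : ℝ → ℝ} (hg : HasCompactSupport g)
    (hv : totalVar g ≠ ⊤) : g ∈ L1c := by
  refine ⟨?_, hg⟩
  rw [← integrableOn_iff_integrable_of_support_subset (subset_tsupport g)]
  exact Measure.integrableOn_of_bounded (M := (totalVar g).toReal)
    (IsCompact.measure_lt_top hg).ne (measurable_of_totalVar_ne_top hv).aestronglyMeasurable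
    (Eventually.of_forall fun x => abs_le_totalVar hg hv x)

/-- The index of the dyadic interval of length `2⁻ⁿ` that contains `x`. -/
noncomputable def dyadicCell (n : ℕ) (x : ℝ) : ℤ := ⌊(2 : ℝ) ^ n * x⌋

theorem dyadicCell_mono (n : ℕ) : Monotone (dyadicCell n) := fun x y h =>
  Int.floor_mono (mul_le_mul_of_nonneg_left h (by positivity))

theorem abs_sub_lt_of_dyadicCell_eq {n : ℕ} {x y : ℝ} (h : dyadicCell n x = dyadicCell n y) :
    |x - y| < (1 / 2) ^ n := by
  have h1 := Int.abs_sub_lt_one_of_floor_eq_floor h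
  rw [← mul_sub, abs_mul, abs_of_pos (by positivity)] at h1
  rw [one_div, inv_pow, ← one_div, lt_div_iff₀ (by positivity), mul_comm]
  exact h1

/-- Enumerate `N` together with the rationals and let each cell choose its first listed point; the
rationals make every cell nonempty. A given point is chosen as soon as the cells separate it from
the finitely many distinct points listed before it. -/
theorem exists_monotone_dyadic_selection {N : Set ℝ} (hN : N.Countable) :
    ∃ node : ℕ → ℤ → ℝ, (∀ n k, dyadicCell n (node n k) = k) ∧
      ∀ x ∈ N, ∀ᶠ n in atTop, node n (dyadicCell n x) = x := by
  obtain ⟨e, he⟩ := (hN.union (Set.countable_range ((↑) : ℚ → ℝ))).exists_eq_range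
    ⟨_, Or.inr ⟨0, rfl⟩⟩
  have hex : ∀ (n : ℕ) (k : ℤ), ∃ i, dyadicCell n (e i) = k := by
    intro n k
    obtain ⟨i, hi⟩ : ((k / 2 ^ n : ℚ) : ℝ) ∈ Set.range e := he ▸ Or.inr ⟨_, rfl⟩
    refine ⟨i, ?_⟩
    rw [hi, dyadicCell]
    push_cast
    rw [mul_div_cancel₀ _ (by positivity), Int.floor_intCast]
  classical
  refine ⟨fun n k => e (Nat.find (hex n k)), fun n k => Nat.find_spec (hex n k), fun x hx => ?_⟩
  obtain ⟨i, rfl⟩ : x ∈ Set.range e := he ▸ Or.inl hx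
  have hsep : ∀ᶠ n in atTop, ∀ j : Fin i, e j = e i ∨ dyadicCell n (e j) ≠ dyadicCell n (e i) := by
    refine eventually_all.2 fun j => ?_
    by_cases hj : e j = e i
    · exact Eventually.of_forall fun n => Or.inl hj
    · have h0 : 0 < |e j - e i| := abs_pos.2 (sub_ne_zero.2 hj)
      have ht := tendsto_pow_atTop_nhds_zero_of_lt_one (r := (1 / 2 : ℝ)) (by norm_num)
        (by norm_num)
      filter_upwards [ht.eventually_lt_const h0] with n hn
      exact Or.inr fun h => (lt_asymm hn (abs_sub_lt_of_dyadicCell_eq h))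
  filter_upwards [hsep] with n hn
  have hle : Nat.find (hex n (dyadicCell n (e i))) ≤ i := Nat.find_min' _ rfl
  rcases hle.eq_or_lt with h | h
  · rw [h]
  · rcases hn ⟨_, h⟩ with h' | h'
    · exact h'
    · exact absurd (Nat.find_spec (hex n (dyadicCell n (e i)))) h'

/-- A function of bounded variation with compact support is a pointwise limit of dyadic step
functions of no larger variation. -/
theorem exists_dyadic_tendsto {g : ℝ → ℝ} (hg : g ∈ L1c) (hv : totalVar g ≠ ⊤) :
    ∃ v : ℕ → ℤ → ℝ, (∀ n, v n ∘ dyadicCell n ∈ L1c) ∧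
      (∀ n, totalVar (v n ∘ dyadicCell n) ≤ totalVar g) ∧
      ∀ x, Tendsto (fun n => v n (dyadicCell n x)) atTop (𝓝 (g x)) := by
  obtain ⟨node, hnode, hN⟩ :=
    exists_monotone_dyadic_selection (countable_not_continuousAt_of_totalVar_ne_top hv)
  have hdist : ∀ n x, |node n (dyadicCell n x) - x| < (1 / 2) ^ n := fun n x =>
    abs_sub_lt_of_dyadicCell_eq (hnode n _)
  have hdist1 : ∀ n x, |node n (dyadicCell n x) - x| < 1 := fun n x =>
    (hdist n x).trans_le (pow_le_one₀ (by norm_num) (by norm_num))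
  have hmono : ∀ n, Monotone fun x => node n (dyadicCell n x) := by
    intro n x y hxy
    rcases (dyadicCell_mono n hxy).eq_or_lt with h | h
    · simp only [h, le_refl]
    · by_contra hcon
      have := dyadicCell_mono n (not_le.1 hcon).le
      rw [hnode, hnode] at this
      omega
  -- Precomposing with a monotone map cannot increase variation.
  have hvar : ∀ n, totalVar ((g ∘ node n) ∘ dyadicCell n) ≤ totalVar g := fun n =>
    eVariationOn.comp_le_of_monotoneOn g (fun x => node n (dyadicCell n x))
      ((hmono n).monotoneOn _) (Set.mapsTo_univ _ _)
  refine ⟨fun n => g ∘ node n, fun n => ?_, hvar, fun x => ?_⟩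
  · refine mem_L1c_of_hasCompactSupport ?_ (ne_top_of_le_ne_top hv (hvar n))
    have hcs := hg.2
    rw [hasCompactSupport_iff_eventuallyEq, coclosedCompact_eq_cocompact,
      cocompact_eq_atBot_atTop] at hcs ⊢
    obtain ⟨hb, ht⟩ := eventually_sup.1 hcs
    have h1 : Tendsto (fun x => node n (dyadicCell n x)) atTop atTop :=
      tendsto_atTop_mono (fun x => by
        simp only [id]
        linarith [(abs_lt.1 (hdist1 n x)).1])
        (tendsto_atTop_add_const_right _ (-1 : ℝ) tendsto_id)
    have h2 : Tendsto (fun x => node n (dyadicCell n x)) atBot atBot :=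
      tendsto_atBot_mono (fun x => by
        simp only [id]
        linarith [(abs_lt.1 (hdist1 n x)).2])
        (tendsto_atBot_add_const_right _ (1 : ℝ) tendsto_id)
    exact eventually_sup.2 ⟨h2.eventually hb, h1.eventually ht⟩
  · have hx : Tendsto (fun n => node n (dyadicCell n x)) atTop (𝓝 x) := by
      rw [tendsto_iff_dist_tendsto_zero]
      exact squeeze_zero (fun _ => dist_nonneg) (fun n => (hdist n x).le)
        (tendsto_pow_atTop_nhds_zero_of_lt_one (by norm_num) (by norm_num))
    -- At a continuity point the nodes tend to `x`; at one of the countably many discontinuities the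
    -- node eventually is `x`.
    by_cases hc : ContinuousAt g x
    · exact hc.tendsto.comp hx
    · refine tendsto_const_nhds.congr' ?_
      filter_upwards [hN x hc] with n hn
      simp [hn]

theorem zero_mem_GAM (p : ℕ) (C : ℝ≥0) : (fun _ => 0) ∈ GAM p C := by
  refine ⟨fun _ _ => 0, fun _ => ⟨by simp, HasCompactSupport.zero⟩, fun _ => by simp, ?_⟩
  have : totalVar (fun _ => 0) = 0 :=
    eVariationOn.constant_on (by rintro _ ⟨_, _, rfl⟩ _ ⟨_, _, rfl⟩; rfl)
  simp [this]

theorem measurable_of_mem_GAM {p : ℕ} {C : ℝ≥0} {f : (Fin p → ℝ) → ℝ} (hf : f ∈ GAM p C) :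
    Measurable f := by
  obtain ⟨g, -, hfg, hC⟩ := hf
  rw [funext hfg]
  exact Finset.measurable_sum _ fun j _ =>
    (measurable_of_totalVar_ne_top (totalVar_ne_top_of_sum_le hC j)).comp (measurable_pi_apply j)

theorem abs_le_of_mem_GAM {p : ℕ} {C : ℝ≥0} {f : (Fin p → ℝ) → ℝ} (hf : f ∈ GAM p C)
    (x : Fin p → ℝ) : |f x| ≤ C := by
  obtain ⟨g, hg, hfg, hC⟩ := hf
  rw [hfg]
  exact (Finset.abs_sum_le_sum_abs _ _).trans ((Finset.sum_le_sum fun j _ =>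
    abs_le_totalVar (hg j).2 (totalVar_ne_top_of_sum_le hC j) (x j)).trans
      (sum_toReal_totalVar_le hC))

/-- The values on dyadic cells of the additive predictors in the class that are step functions. -/
def dyadicGAM (p : ℕ) (C : ℝ≥0) (n : ℕ) : Set (Fin p → ℤ → ℝ) :=
  {v | (∀ j, v j ∘ dyadicCell n ∈ L1c) ∧ ∑ j, totalVar (v j ∘ dyadicCell n) ≤ (C : ℝ≥0∞)}

/-- The additive step function with the values `v`. -/
noncomputable def dyadicPredictor {p : ℕ} (n : ℕ) (v : Fin p → ℤ → ℝ) (x : Fin p → ℝ) : ℝ :=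
  ∑ j, v j (dyadicCell n (x j))

theorem dyadicPredictor_mem_GAM {p : ℕ} {C : ℝ≥0} {n : ℕ} {v : Fin p → ℤ → ℝ}
    (hv : v ∈ dyadicGAM p C n) : dyadicPredictor n v ∈ GAM p C :=
  ⟨fun j => v j ∘ dyadicCell n, hv.1, fun _ => rfl, hv.2⟩

/-- The class is generated from a countable subclass by pointwise limits of sequences. -/
theorem exists_countable_generating_GAM (p : ℕ) (C : ℝ≥0) :
    ∃ T ⊆ GAM p C, T.Countable ∧ ∀ S : Set ((Fin p → ℝ) → ℝ), T ⊆ S →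
      (∀ (u : ℕ → (Fin p → ℝ) → ℝ), (∀ n, u n ∈ GAM p C) → (∀ n, u n ∈ S) →
        ∀ f ∈ GAM p C, (∀ x, Tendsto (fun n => u n x) atTop (𝓝 (f x))) → f ∈ S) →
      GAM p C ⊆ S := by
  -- Cell values lie in a countable product of lines, which is second countable, so every subset is
  -- separable. The closure property is used twice: within a fixed grid, then as the grid is
  -- refined.
  choose K hKc hKd using fun n => TopologicalSpace.exists_countable_dense (dyadicGAM p C n)
  refine ⟨⋃ n, (fun v : dyadicGAM p C n => dyadicPredictor n v.1) '' K n, ?_,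
    Set.countable_iUnion fun n => (hKc n).image _, fun S hT hS => ?_⟩
  · refine Set.iUnion_subset fun n => ?_
    rintro _ ⟨v, -, rfl⟩
    exact dyadicPredictor_mem_GAM v.2
  have hgrid : ∀ n, ∀ v ∈ dyadicGAM p C n, dyadicPredictor n v ∈ S := by
    intro n v hv
    obtain ⟨w, hw, hlim⟩ := mem_closure_iff_seq_limit.1 (hKd n ⟨v, hv⟩)
    refine hS (fun k => dyadicPredictor n (w k).1) (fun k => dyadicPredictor_mem_GAM (w k).2)
      (fun k => hT (Set.mem_iUnion.2 ⟨n, w k, hw k, rfl⟩)) _ (dyadicPredictor_mem_GAM hv)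
      fun x => tendsto_finsetSum _ fun j _ => ?_
    have h1 : Tendsto (fun k => (w k).1) atTop (𝓝 v) :=
      (continuous_subtype_val.tendsto _).comp hlim
    exact (tendsto_pi_nhds.1 (tendsto_pi_nhds.1 h1 j)) _
  rintro f ⟨g, hg, hfg, hC⟩
  choose v hv1 hv2 hv3 using fun j => exists_dyadic_tendsto (hg j) (totalVar_ne_top_of_sum_le hC j)
  have hmem : ∀ n, (fun j => v j n) ∈ dyadicGAM p C n := fun n =>
    ⟨fun j => hv1 j n, (Finset.sum_le_sum fun j _ => hv2 j n).trans hC⟩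
  refine hS (fun n => dyadicPredictor n fun j => v j n)
    (fun n => dyadicPredictor_mem_GAM (hmem n)) (fun n => hgrid n _ (hmem n)) f
    ⟨g, hg, hfg, hC⟩ fun x => ?_
  rw [hfg]
  exact tendsto_finsetSum _ fun j _ => hv3 j (x j)

/-! ### Uniform deviation and risk bounds. -/

theorem abs_iSup_sub_iSup_le {ι : Type*} [Nonempty ι] {F G : ι → ℝ} (hF : BddFamily F)
    (hG : BddFamily G) {b : ℝ} (h : ∀ f, |F f - G f| ≤ b) : |(⨆ f, F f) - ⨆ f, G f| ≤ b := by
  rw [abs_le]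
  constructor
  · have : (⨆ f, G f) ≤ (⨆ f, F f) + b := ciSup_le fun f => by
      linarith [le_ciSup hF.bddAbove f, (abs_le.1 (h f)).1]
    linarith
  · have : (⨆ f, F f) ≤ (⨆ f, G f) + b := ciSup_le fun f => by
      linarith [le_ciSup hG.bddAbove f, (abs_le.1 (h f)).2]
    linarith

/-- A uniform deviation inequality in terms of a bound for the empirical Rademacher averages. -/
theorem measureReal_iSup_gap_ge_le {X ι : Type*} [MeasurableSpace X] [Countable ι] [Nonempty ι]
    (D : Measure X) [IsProbabilityMeasure D] {m : ℕ} (hm : 0 < m) {h : ι → X → ℝ} {c B r : ℝ}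
    (hc0 : 0 ≤ c) (hh : ∀ f, Measurable (h f)) (hc : ∀ f x, |h f x| ≤ c)
    (hB : ∀ s : Fin m → X,
      ∑ σ : Fin m → Bool, ⨆ f, ∑ i, (coinSign (σ i) : ℝ) * h f (s i) ≤ 2 ^ m * B) (hr : 0 ≤ r) :
    MeasurableSet {s : Fin m → X | 2 / m * B + r ≤
      ⨆ f, (∫ x, h f x ∂D - 1 / (m : ℝ) * ∑ i, h f (s i))} ∧
    (Measure.pi fun _ => D).real {s : Fin m → X | 2 / m * B + r ≤
      ⨆ f, (∫ x, h f x ∂D - 1 / (m : ℝ) * ∑ i, h f (s i))} ≤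
      Real.exp (-r ^ 2 / (2 * (c ^ 2 / m))) := by
  have hm0 : (0 : ℝ) < m := by exact_mod_cast hm
  set Φ : (Fin m → X) → ℝ := fun s =>
    ⨆ f, (∫ x, h f x ∂D - 1 / (m : ℝ) * ∑ i, h f (s i)) with hΦ
  have hΦm : Measurable Φ := Measurable.iSup fun f =>
    measurable_const.sub ((Finset.measurable_sum _ fun i _ =>
      (hh f).comp (measurable_pi_apply i)).const_mul _)
  have hbd : ∀ (s : Fin m → X) f, |∫ x, h f x ∂D - 1 / (m : ℝ) * ∑ i, h f (s i)| ≤ c + c := fun s f =>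
    (abs_sub _ _).trans (add_le_add (abs_integral_le_of_abs_le (hc f))
      (abs_average_le hm fun i => hc f (s i)))
  have hdiff : ∀ s i x, |Φ s - Φ (Function.update s i x)| ≤ 2 * c / m := by
    intro s i x
    refine abs_iSup_sub_iSup_le (bddFamily_of_abs_le (hbd s)) (bddFamily_of_abs_le (hbd _))
      fun f => ?_
    have hsum : ∑ k, h f (Function.update s i x k) - ∑ k, h f (s k) = h f x - h f (s i) := by
      rw [← Finset.sum_sub_distrib, Finset.sum_eq_single i]
      · simp
      · intro k _ hk
        simp [Function.update_of_ne hk]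
      · simp
    rw [sub_sub_sub_cancel_left, ← mul_sub, hsum, abs_mul, abs_of_pos (by positivity),
      one_div_mul_eq_div]
    gcongr
    exact (abs_sub _ _).trans (by linarith [hc f x, hc f (s i)])
  refine ⟨measurableSet_le measurable_const hΦm, ?_⟩
  have hmain := measureReal_ge_le_of_bounded_differences D (b := 2 * c / m) (by positivity) hΦm
    (fun s => abs_iSup_le (hbd s)) hdiff hr
  rw [show (m : ℝ) * (2 * c / m / 2) ^ 2 = c ^ 2 / m by field_simp] at hmain
  refine le_trans (measureReal_mono fun s hs => ?_) hmain
  have := integral_iSup_gap_le D hm hh hc hB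
  simp only [Set.mem_ofPred_eq] at hs ⊢
  linarith

theorem sum_coinSign_eq_zero {m : ℕ} (i : Fin m) :
    ∑ σ : Fin m → Bool, (coinSign (σ i) : ℝ) = 0 := by
  have h := (Equiv.arrowCongr (Equiv.refl (Fin m)) Equiv.boolNot).sum_comp
    (fun σ : Fin m → Bool => (coinSign (σ i) : ℝ))
  have h2 : ∑ σ : Fin m → Bool,
      (coinSign ((Equiv.arrowCongr (Equiv.refl (Fin m)) Equiv.boolNot) σ i) : ℝ) =
      -∑ σ : Fin m → Bool, (coinSign (σ i) : ℝ) := by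
    rw [← Finset.sum_neg_distrib]
    refine Finset.sum_congr rfl fun σ _ => ?_
    cases hσ : σ i <;> simp [coinSign, Equiv.arrowCongr, hσ]
  linarith

theorem tendsto_empRisk {p m : ℕ} {Y : Type*} {ℓ : ℝ → Y → ℝ} {ρ : ℝ≥0}
    (hℓ_lip : ∀ y, LipschitzWith ρ (fun a => ℓ a y))
    {u : ℕ → (Fin p → ℝ) → ℝ} {f : (Fin p → ℝ) → ℝ}
    (hf : ∀ x, Tendsto (fun n => u n x) atTop (𝓝 (f x))) (s : Fin m → (Fin p → ℝ) × Y) :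
    Tendsto (fun n => empRisk ℓ s (u n)) atTop (𝓝 (empRisk ℓ s f)) :=
  (tendsto_finsetSum _ fun i _ =>
    ((hℓ_lip (s i).2).continuous.tendsto _).comp (hf (s i).1)).const_mul _

/-- The Rademacher averages of the losses of the additive predictors. -/
theorem sum_iSup_coinSign_mul_loss_le {p m : ℕ} {Y : Type*} {ℓ : ℝ → Y → ℝ} {ρ : ℝ≥0} {c : ℝ}
    {C : ℝ≥0} (hp : 2 < p) (hm : 0 < m)
    (hℓ_lip : ∀ y, LipschitzWith ρ (fun a => ℓ a y)) (hℓ_bdd : ∀ a y, |ℓ a y| ≤ c)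
    {T : Set ((Fin p → ℝ) → ℝ)} (hT : T ⊆ GAM p C) [Nonempty T]
    (s : Fin m → (Fin p → ℝ) × Y) :
    ∑ σ : Fin m → Bool, ⨆ f : T, ∑ i, (coinSign (σ i) : ℝ) * ℓ (f.1 (s i).1) (s i).2 ≤
      2 ^ m * (ρ * (C / 2 * √(5 * (⌈Real.log p⌉₊ : ℝ) * m))) := by
  have h := sum_iSup_coinSign_mul_le_of_contraction (ι := T) (u := fun _ => 0)
    (s := fun i f => ℓ (f.1 (s i).1) (s i).2) (r := fun i f => ρ * f.1 (s i).1)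
    ⟨0, by simp⟩ (fun i => ⟨c, fun f => hℓ_bdd _ _⟩)
    (fun i => BddFamily.const_mul ⟨C, fun f => abs_le_of_mem_GAM (hT f.2) _⟩ _) fun i f g => by
      have := (hℓ_lip (s i).2).dist_le_mul (f.1 (s i).1) (g.1 (s i).1)
      rwa [Real.dist_eq, Real.dist_eq, ← abs_of_nonneg ρ.coe_nonneg, ← abs_mul,
        mul_sub] at this
  simp only [zero_add] at h
  refine h.trans ?_
  set τ : Fin p → Equiv.Perm (Fin m) := fun j => Tuple.sort fun i => (s i).1 j with hτ
  calc _ ≤ ∑ σ : Fin m → Bool, (ρ : ℝ) * (C / 2 * ⨆ j, (coinRange (σ ∘ τ j) : ℝ)) := by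
        refine Finset.sum_le_sum fun σ _ => ciSup_le fun f => ?_
        have h1 := sum_coinSign_mul_le_of_mem_GAM (hT f.2) (fun i => (s i).1) σ
        refine le_trans (le_of_eq ?_) (mul_le_mul_of_nonneg_left h1 ρ.coe_nonneg)
        rw [Finset.mul_sum]
        exact Finset.sum_congr rfl fun i _ => mul_left_comm _ _ _
    _ = ρ * (C / 2 * ∑ σ : Fin m → Bool, ⨆ j, (coinRange (σ ∘ τ j) : ℝ)) := by
        rw [Finset.mul_sum, Finset.mul_sum]
    _ ≤ ρ * (C / 2 * (2 ^ m * √(5 * (⌈Real.log p⌉₊ : ℝ) * m))) := by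
        gcongr
        exact sum_iSup_coinRange_le hp hm τ
    _ = _ := by ring

section Risk

variable {p m : ℕ} {Y : Type*} [MeasurableSpace Y] {ℓ : ℝ → Y → ℝ} {ρ : ℝ≥0} {c : ℝ}

theorem measurable_loss_comp (hℓ_meas : ∀ a, Measurable (ℓ a))
    (hℓ_lip : ∀ y, LipschitzWith ρ (fun a => ℓ a y)) {f : (Fin p → ℝ) → ℝ} (hf : Measurable f) :
    Measurable fun z : (Fin p → ℝ) × Y => ℓ (f z.1) z.2 :=
  (measurable_uncurry_of_continuous_of_measurable (fun y => (hℓ_lip y).continuous) hℓ_meas).comp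
    ((hf.comp measurable_fst).prodMk measurable_snd)

theorem tendsto_expRisk (D : Measure ((Fin p → ℝ) × Y)) [IsProbabilityMeasure D]
    (hℓ_meas : ∀ a, Measurable (ℓ a)) (hℓ_lip : ∀ y, LipschitzWith ρ (fun a => ℓ a y))
    (hℓ_bdd : ∀ a y, |ℓ a y| ≤ c) {u : ℕ → (Fin p → ℝ) → ℝ} (hu : ∀ n, Measurable (u n))
    {f : (Fin p → ℝ) → ℝ} (hf : ∀ x, Tendsto (fun n => u n x) atTop (𝓝 (f x))) :
    Tendsto (fun n => expRisk ℓ D (u n)) atTop (𝓝 (expRisk ℓ D f)) :=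
  tendsto_integral_of_dominated_convergence (fun _ => c)
    (fun n => (measurable_loss_comp hℓ_meas hℓ_lip (hu n)).aestronglyMeasurable)
    (integrable_const c) (fun _ => Eventually.of_forall fun _ => hℓ_bdd _ _)
    (Eventually.of_forall fun z => ((hℓ_lip z.2).continuous.tendsto _).comp (hf z.1))

theorem abs_expRisk_sub_empRisk_le (D : Measure ((Fin p → ℝ) × Y)) [IsProbabilityMeasure D]
    (hm : 0 < m) (hℓ_bdd : ∀ a y, |ℓ a y| ≤ c) (s : Fin m → (Fin p → ℝ) × Y)
    (f : (Fin p → ℝ) → ℝ) : |expRisk ℓ D f - empRisk ℓ s f| ≤ c + c :=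
  (abs_sub _ _).trans (add_le_add (abs_integral_le_of_abs_le fun _ => hℓ_bdd _ _)
    (abs_average_le hm fun _ => hℓ_bdd _ _))

/-- The generalization bound on the sample space, with a measurable good event. -/
theorem exists_measurableSet_forall_gap_le (hp : 2 < p) (hm : 0 < m)
    (D : Measure ((Fin p → ℝ) × Y)) [IsProbabilityMeasure D] (hc : 0 ≤ c)
    (hℓ_meas : ∀ a, Measurable (ℓ a)) (hℓ_lip : ∀ y, LipschitzWith ρ (fun a => ℓ a y))
    (hℓ_bdd : ∀ a y, |ℓ a y| ≤ c) (C : ℝ≥0) {r : ℝ} (hr : 0 ≤ r) :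
    ∃ G : Set (Fin m → (Fin p → ℝ) × Y), MeasurableSet G ∧
      (Measure.pi fun _ => D).real Gᶜ ≤ Real.exp (-r ^ 2 / (2 * (c ^ 2 / m))) ∧
      ∀ s ∈ G, ∀ f ∈ GAM p C, expRisk ℓ D f - empRisk ℓ s f ≤
        ρ * C * √(5 * (⌈Real.log p⌉₊ : ℝ) / m) + r := by
  have hm0 : (0 : ℝ) < m := by exact_mod_cast hm
  obtain ⟨T, hTG, hTc, hgen⟩ := exists_countable_generating_GAM p C
  have : Countable T := hTc
  have : Nonempty T := by
    by_contra hne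
    have hT : T = ∅ := Set.not_nonempty_iff_eq_empty.1 fun h => hne h.to_subtype
    -- The empty set is closed under limits of sequences, so an empty `T` would generate nothing,
    -- yet the class contains 0.
    exact hgen ∅ hT.subset (fun u _ hu => (hu 0).elim) (zero_mem_GAM p C)
  obtain ⟨hmeas, hprob⟩ := measureReal_iSup_gap_ge_le D hm
    (h := fun (f : T) (z : (Fin p → ℝ) × Y) => ℓ (f.1 z.1) z.2) hc
    (fun f => measurable_loss_comp hℓ_meas hℓ_lip (measurable_of_mem_GAM (hTG f.2)))
    (fun f z => hℓ_bdd _ _) (sum_iSup_coinSign_mul_loss_le hp hm hℓ_lip hℓ_bdd hTG) hr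
  refine ⟨_, hmeas.compl, by rwa [compl_compl], fun s hs => ?_⟩
  -- The factor 2 from symmetrization cancels the half from centering the walk.
  have hcst : 2 / (m : ℝ) * (ρ * (C / 2 * √(5 * (⌈Real.log p⌉₊ : ℝ) * m))) =
      ρ * C * √(5 * (⌈Real.log p⌉₊ : ℝ) / m) := by
    rw [show 5 * (⌈Real.log p⌉₊ : ℝ) * m = 5 * (⌈Real.log p⌉₊ : ℝ) / m * m ^ 2 by field_simp,
      Real.sqrt_mul (by positivity), Real.sqrt_sq hm0.le]
    field_simp
  simp only [Set.mem_compl_iff, Set.mem_ofPred_eq, not_le] at hs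
  rw [hcst] at hs
  have hall : GAM p C ⊆ {f | expRisk ℓ D f - empRisk ℓ s f ≤
      ρ * C * √(5 * (⌈Real.log p⌉₊ : ℝ) / m) + r} := by
    refine hgen _ (fun f hf => ?_) fun u huG hu f hf hlim => ?_
    · exact (le_ciSup (f := fun f : T => expRisk ℓ D f.1 - empRisk ℓ s f.1)
        (bddFamily_of_abs_le fun f : T =>
          abs_expRisk_sub_empRisk_le D hm hℓ_bdd s f.1).bddAbove ⟨f, hf⟩).trans hs.le
    · exact le_of_tendsto' ((tendsto_expRisk D hℓ_meas hℓ_lip hℓ_bdd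
        (fun n => measurable_of_mem_GAM (huG n)) hlim).sub (tendsto_empRisk hℓ_lip hlim s)) hu
  exact hall

/-- Hoeffding's inequality for the empirical risk of a fixed predictor. -/
theorem exists_measurableSet_empRisk_le (hm : 0 < m)
    (D : Measure ((Fin p → ℝ) × Y)) [IsProbabilityMeasure D] (hc : 0 ≤ c)
    (hℓ_meas : ∀ a, Measurable (ℓ a)) (hℓ_lip : ∀ y, LipschitzWith ρ (fun a => ℓ a y))
    (hℓ_bdd : ∀ a y, |ℓ a y| ≤ c) {f : (Fin p → ℝ) → ℝ} (hf : Measurable f) {r : ℝ}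
    (hr : 0 ≤ r) :
    ∃ G : Set (Fin m → (Fin p → ℝ) × Y), MeasurableSet G ∧
      (Measure.pi fun _ => D).real Gᶜ ≤ Real.exp (-r ^ 2 / (2 * (c ^ 2 / m))) ∧
      ∀ s ∈ G, empRisk ℓ s f ≤ expRisk ℓ D f + r := by
  -- The class consists of the single function `-ℓ`, whose Rademacher average is zero, hence `B =
  -- 0`; the sign reverses the deviation.
  obtain ⟨hmeas, hprob⟩ := measureReal_iSup_gap_ge_le D hm (B := 0)
    (h := fun (_ : Unit) (z : (Fin p → ℝ) × Y) => -ℓ (f z.1) z.2) hc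
    (fun _ => (measurable_loss_comp hℓ_meas hℓ_lip hf).neg)
    (fun _ z => by rw [abs_neg]; exact hℓ_bdd _ _) (fun s => by
      simp only [ciSup_const]
      rw [Finset.sum_comm]
      simp [← Finset.sum_mul, sum_coinSign_eq_zero]) hr
  refine ⟨_, hmeas.compl, by rwa [compl_compl], fun s hs => ?_⟩
  simp only [Set.mem_compl_iff, Set.mem_ofPred_eq, not_le] at hs
  simp only [ciSup_const, integral_neg, Finset.sum_neg_distrib] at hs
  unfold empRisk expRisk
  linarith

end Risk

/-! ### Transfer to the probability space and conclusion. -/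

theorem probAtLeast_of_one_le {Ω : Type*} [MeasurableSpace Ω] (μ : Measure Ω) {δ : ℝ}
    (hδ : 1 ≤ δ) (E : Set Ω) : ProbAtLeast μ (1 - δ) E :=
  ⟨∅, Set.empty_subset _, MeasurableSet.empty, by simpa using hδ⟩

theorem probAtLeast_of_preimage {Ω S : Type*} [MeasurableSpace Ω] [MeasurableSpace S]
    {μ : Measure Ω} [IsProbabilityMeasure μ] {P : Measure S} {W : Ω → S}
    (hW : MeasurePreserving W μ P) {G : Set S} (hG : MeasurableSet G) {δ : ℝ}
    (hδ : P.real Gᶜ ≤ δ) {E : Set Ω} (hE : ∀ ω, W ω ∈ G → ω ∈ E) : ProbAtLeast μ (1 - δ) E := by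
  refine ⟨W ⁻¹' G, hE, hW.measurable hG, ?_⟩
  have h := hW.measureReal_preimage hG.compl.nullMeasurableSet
  rw [Set.preimage_compl, probReal_compl_eq_one_sub (hW.measurable hG)] at h
  linarith

theorem corollary1 {Ω Y : Type*} [MeasurableSpace Ω] [MeasurableSpace Y]
    (μ : Measure Ω) [IsProbabilityMeasure μ]
    (p m : ℕ) (hp : 2 < p) (hm : 0 < m)
    -- the law of the test pair, and an i.i.d. sample from it
    (D : Measure ((Fin p → ℝ) × Y)) [IsProbabilityMeasure D]
    (Z : Fin m → Ω → (Fin p → ℝ) × Y)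
    (hZ_meas : ∀ i, Measurable (Z i))
    (hZ_law : ∀ i, μ.map (Z i) = D)
    (hZ_indep : iIndepFun Z μ)
    -- the loss
    (ℓ : ℝ → Y → ℝ) (ρ : ℝ≥0) (c : ℝ) (hc : 0 < c)
    (hℓ_meas : ∀ a, Measurable (ℓ a))
    (hℓ_lip : ∀ y, LipschitzWith ρ (fun a => ℓ a y))
    (hℓ_bdd : ∀ a y, |ℓ a y| ≤ c)
    (C : ℝ≥0) (δ : ℝ) (hδ : 0 < δ) :
    ProbAtLeast μ (1 - δ)
      {ω | worstGap ℓ D C (fun i => Z i ω) ≤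
        ρ * C * √(5 * (⌈Real.log p⌉₊ : ℝ) / m) + c * √(2 * Real.log (2 / δ) / m)} ∧
    ProbAtLeast μ (1 - δ)
      {ω | ∀ f, IsERM ℓ C (fun i => Z i ω) f →
        expRisk ℓ D f ≤ optRisk ℓ D C +
          ρ * C * √(5 * (⌈Real.log p⌉₊ : ℝ) / m) + 5 * c * √(2 * Real.log (2 / δ) / m)} := by
  rcases le_or_gt 1 δ with h1 | h1
  · exact ⟨probAtLeast_of_one_le μ h1 _, probAtLeast_of_one_le μ h1 _⟩
  have hm0 : (0 : ℝ) < m := by exact_mod_cast hm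
  have hlog : 0 < Real.log (2 / δ) := Real.log_pos (by rw [lt_div_iff₀ hδ]; linarith)
  set r : ℝ := c * √(2 * Real.log (2 / δ) / m) with hr
  have hr0 : 0 < r := mul_pos hc (Real.sqrt_pos.2 (by positivity))
  -- Each good event fails with probability at most `δ / 2`: the first claim needs one event, the
  -- second needs two.
  have hexp : Real.exp (-r ^ 2 / (2 * (c ^ 2 / m))) = δ / 2 := by
    rw [hr, mul_pow, Real.sq_sqrt (by positivity),
      show -(c ^ 2 * (2 * Real.log (2 / δ) / m)) / (2 * (c ^ 2 / m)) = -Real.log (2 / δ) by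
        field_simp,
      Real.exp_neg, Real.exp_log (by positivity), inv_div]
  have hW : MeasurePreserving (fun ω i => Z i ω) μ (Measure.pi fun _ => D) :=
    ⟨measurable_pi_iff.2 hZ_meas, by
      rw [(iIndepFun_iff_map_fun_eq_pi_map fun i => (hZ_meas i).aemeasurable).1 hZ_indep]
      simp_rw [hZ_law]⟩
  have hne : Nonempty (GAM p C) := ⟨⟨_, zero_mem_GAM p C⟩⟩
  obtain ⟨G, hGm, hGp, hG⟩ :=
    exists_measurableSet_forall_gap_le hp hm D hc.le hℓ_meas hℓ_lip hℓ_bdd C hr0.le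
  rw [hexp] at hGp
  refine ⟨probAtLeast_of_preimage hW hGm (hGp.trans (by linarith)) fun ω hω => ?_, ?_⟩
  · exact ciSup_le fun f : GAM p C => hG _ hω f.1 f.2
  -- The infimum need not be attained, so a competitor within `r` of it is used. The excess is then
  -- `3 * r`: the uniform gap, Hoeffding for `g`, and the slack of `g`; the stated `5 * r` leaves
  -- room.
  obtain ⟨g, hg⟩ : ∃ g : GAM p C, expRisk ℓ D g.1 < optRisk ℓ D C + r :=
    exists_lt_of_ciInf_lt (lt_add_of_pos_right _ hr0)
  obtain ⟨H, hHm, hHp, hH⟩ := exists_measurableSet_empRisk_le hm D hc.le hℓ_meas hℓ_lip hℓ_bdd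
    (measurable_of_mem_GAM g.2) hr0.le
  rw [hexp] at hHp
  refine probAtLeast_of_preimage hW (hGm.inter hHm) ?_ fun ω hω => ?_
  · rw [Set.compl_inter]
    exact (measureReal_union_le _ _).trans (by linarith)
  · intro f hf
    have h2 := hG _ hω.1 f hf.1
    have h3 := hH _ hω.2
    have h4 : empRisk ℓ (fun i => Z i ω) f ≤ empRisk ℓ (fun i => Z i ω) g.1 := hf.2 g.2
    rw [mul_assoc 5 c, ← hr]
    linarith
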